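/- **Proposition.** *The quiver $\mathcal{FQ}$ with the operations $b_n$ defined below is an $A_\infty$-category.* Conventions. Let $k$ be a commutative ring and $\mathcal Q$ a (small) differential graded $k$-quiver: a set of objects and a complex of $k$-modules $\mathcal Q(X,Y)$, with differential of degree $+1$, for each pair of objects. For a graded module (or complex) $P$ let $P[n]^d=P^{d+n}$, let $s^n:P\to P[n]$ be the identity map on elements, of degree $-n$, and let $d_{P[n]}=(-1)^n s^{-n}\,d_P\,s^n$; put $sP=P[1]$. Maps are written on the right and composed from left to right, and $(x\otimes y)(f\otimes g)=(-1)^{\deg y\cdot\deg f}\,xf\otimes yg$. For a tensor product, $(M\otimes N)[n]=M\otimes (N[n])$ and $s^n=1\otimes s^n$. An $A_\infty$-category is a graded $k$-quiver $\mathcal A$ with $k$-linear maps $b_n: s\mathcal A(X_0,X_1)\otimes\dots\otimes s\mathcal A(X_{n-1},X_n)\to s\mathcal A(X_0,X_n)$, $n\ge1$, of degree $1$ such that for all $m\ge 1$ $$\sum_{r+n+t=m,\ n\ge1}(1^{\otimes r}\otimes b_n\otimes 1^{\otimes t})\,b_{r+1+t}=0 .$$ Trees. Let $\mathcal T^n_{\ge2}$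 be the set of isomorphism classes of plane rooted trees with $n$ input vertices in which each internal vertex has at least two edges going up (away from the root). The tree $|$ without internal vertices is the only element of $\mathcal T^1_{\ge2}$. Let $|t|$ be the number of internal vertices of $t$. Order the internal vertices of $t$ linearly so that each vertex precedes the vertices above it, and, of two incomparable vertices, the one lying on the left comes first; the height $h(v)\in\{1,\dots,|t|\}$ is the position of $v$ in this order. Let $\mathfrak t_k$ be the corolla with one internal vertex and $k$ inputs, and let $(t_1\sqcup\dots\sqcup t_k)\cdot\mathfrak t_k$ be the tree obtained by grafting the trees $t_1,\dots,t_k$ onto its inputs. The quiver. $\mathcal{FQ}$ has the objects of $\mathcal Q$, and its graded modules of morphisms are given by $$s\mathcal{FQ}(X,Y)=\bigoplus_{n\ge1}\ \bigoplus_{t\in\mathcal T^n_{\ge2}} s\mathcal F_t\mathcal Q(X,Y),$$ $$s\mathcal F_t\mathcal Q(X,Y)=\bigoplus_{X=X_0,X_1,\dots,X_n=Y} s\mathcal Q(X_0,X_1)\otimes\dots\otimes s\mathcal Q(X_{n-1},X_n)\,[-|t|].$$ The operations. For $k>1$, $b_k$ is the direct sum of the maps $$s^{|t_1|}\otimes\dots\otimes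 s^{|t_{k-1}|}\otimes s^{|t_k|-|t|}:\ s\mathcal F_{t_1}\mathcal Q(Y_0,Y_1)\otimes\dots\otimes s\mathcal F_{t_k}\mathcal Q(Y_{k-1},Y_k)\to s\mathcal F_t\mathcal Q(Y_0,Y_k),$$ where $t=(t_1\sqcup\dots\sqcup t_k)\cdot\mathfrak t_k$. The restriction of $b_1$ to $s\mathcal F_t\mathcal Q$, $t\in\mathcal T^n_{\ge2}$, is $$d+\sum_{(t',e)}(-1)^{1+h(v_e)}\,s^{-1}:\ s\mathcal F_t\mathcal Q(X,Y)\to s\mathcal F_t\mathcal Q(X,Y)\oplus\bigoplus_{(t',e)} s\mathcal F_{t'}\mathcal Q(X,Y).$$ Here $(t',e)$ runs over all $t'\in\mathcal T^n_{\ge2}$ with a distinguished edge $e$ whose contraction gives $t$, $v_e$ is the highest vertex of $e$, $h(v_e)$ is its height in $t'$, $s^{-1}$ means $1^{\otimes(n-1)}\otimes s^{-1}$, and $d=d\otimes1\otimes\dots\otimes1+\dots+1\otimes\dots\otimes1\otimes d$, where the last $d$ is the differential of $s\mathcal Q[-|t|]$. -/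

import Mathlib

open CategoryTheory
open scoped TensorProduct

universe u v w

namespace FreeAInf

/-! ### Graded quivers and `A∞`-categories -/

/-- A `ℤ`-graded `k`-linear quiver: `Hom X Y` is the direct sum of its homogeneous parts
`deg X Y d`. -/
structure GradedQuiver (k : Type u) [CommRing k] where
  Obj : Type v
  Hom : Obj → Obj → Type w
  [addCommGroup : ∀ X Y, AddCommGroup (Hom X Y)]
  [module : ∀ X Y, Module k (Hom X Y)]
  deg : ∀ X Y, ℤ → Submodule k (Hom X Y)
  isInternal : ∀ X Y, DirectSum.IsInternal (deg X Y)

attribute [instance] GradedQuiver.addCommGroup GradedQuiver.module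

/-- The degree `d` part of `sA(X,Y) = A(X,Y)[1]`, that is, `(sA)^d = A^{d+1}`. -/
def GradedQuiver.sDeg {k : Type u} [CommRing k] (A : GradedQuiver.{u, v, w} k) (X Y : A.Obj)
    (d : ℤ) : Submodule k (A.Hom X Y) :=
  A.deg X Y (d + 1)

/-- Composable sequences `(x₁, …, xₙ)`, `n ≥ 0`, with `xⱼ ∈ A(X_{j-1}, X_j)`, `X₀ = X`, `Xₙ = Y`. -/
inductive Chain {k : Type u} [CommRing k] (A : GradedQuiver.{u, v, w} k) :
    A.Obj → A.Obj → Type (max v w)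
  | nil (X : A.Obj) : Chain A X X
  | cons {X Y Z : A.Obj} (x : A.Hom X Y) (c : Chain A Y Z) : Chain A X Z

namespace Chain

variable {k : Type u} [CommRing k] {A : GradedQuiver.{u, v, w} k}

def length : {X Y : A.Obj} → Chain A X Y → ℕ
  | _, _, nil _ => 0
  | _, _, cons _ c => c.length + 1

def append : {X Y Z : A.Obj} → Chain A X Y → Chain A Y Z → Chain A X Z
  | _, _, _, nil _, c' => c'
  | _, _, _, cons x c, c' => cons x (c.append c')

/-- The object `X_r` of `(x₁, …, xₙ)` (the last one if `r > n`). -/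
def obj : {X Y : A.Obj} → Chain A X Y → ℕ → A.Obj
  | X, _, nil _, _ => X
  | X, _, cons _ _, 0 => X
  | _, _, cons _ c, r + 1 => c.obj r

/-- `(x₁, …, x_r)`. -/
def take : {X Y : A.Obj} → (c : Chain A X Y) → (r : ℕ) → Chain A X (c.obj r)
  | _, _, nil X, _ => nil X
  | X, _, cons _ _, 0 => nil X
  | _, _, cons x c, r + 1 => cons x (c.take r)

/-- `(x_{r+1}, …, xₙ)`. -/
def drop : {X Y : A.Obj} → (c : Chain A X Y) → (r : ℕ) → Chain A (c.obj r) Y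
  | _, _, nil X, _ => nil X
  | _, _, cons x c, 0 => cons x c
  | _, _, cons _ c, r + 1 => c.drop r

/-- `c.HasSDegrees [i₁, …, iₙ]` says that `c = (x₁, …, xₙ)` has `n` entries and that `xⱼ` is
homogeneous of degree `iⱼ` as an element of `sA`. -/
def HasSDegrees : {X Y : A.Obj} → Chain A X Y → List ℤ → Prop
  | _, _, nil _, [] => True
  | X, _, @cons _ _ _ _ Y _ x c, i :: is => x ∈ A.sDeg X Y i ∧ c.HasSDegrees is
  | _, _, _, _ => False

end Chain

/-- `A` together with the operations `b` is an `A∞`-category. For `n ≥ 1`, the restriction of `b`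
to sequences of length `n` is the operation
`bₙ : sA(X₀,X₁) ⊗ ⋯ ⊗ sA(X_{n-1},Xₙ) → sA(X₀,Xₙ)`, given as a `k`-multilinear map.

Operators are written on the right, so `(x ⊗ y)(f ⊗ g) = (-1)^{deg y · deg f} xf ⊗ yg`. Hence
`(x₁ ⊗ ⋯ ⊗ x_m)(1^{⊗r} ⊗ bₙ ⊗ 1^{⊗t})` carries the sign given by the total degree of the last `t`
factors. -/
structure IsAInfCategory {k : Type u} [CommRing k] (A : GradedQuiver.{u, v, w} k)
    (b : ∀ {X Y : A.Obj}, Chain A X Y → A.Hom X Y) : Prop where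
  /-- There is no operation `b₀`. -/
  b_nil : ∀ X : A.Obj, b (Chain.nil X) = 0
  b_add : ∀ {X Y Z W : A.Obj} (l : Chain A X Y) (x x' : A.Hom Y Z) (r : Chain A Z W),
    b (l.append (.cons (x + x') r)) = b (l.append (.cons x r)) + b (l.append (.cons x' r))
  b_smul : ∀ {X Y Z W : A.Obj} (l : Chain A X Y) (a : k) (x : A.Hom Y Z) (r : Chain A Z W),
    b (l.append (.cons (a • x) r)) = a • b (l.append (.cons x r))
  /-- Each `bₙ` has degree `1`. -/
  b_mem : ∀ {X Y : A.Obj} (c : Chain A X Y) (is : List ℤ), c.HasSDegrees is →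
    b c ∈ A.sDeg X Y (is.sum + 1)
  /-- `∑_{r+n+t=m} (1^{⊗r} ⊗ bₙ ⊗ 1^{⊗t}) b_{r+1+t} = 0`, where `n ≥ 1`. -/
  b_b : ∀ {X Y : A.Obj} (c : Chain A X Y) (is : List ℤ), c.HasSDegrees is →
    ∑ r ∈ Finset.range c.length, ∑ n ∈ Finset.Icc 1 (c.length - r),
      (is.drop (r + n)).sum.negOnePow •
        b ((c.take r).append (.cons (b ((c.drop r).take n)) ((c.drop r).drop n))) = 0

/-! ### Plane rooted trees -/

/-- Plane rooted trees, up to isomorphism. `leaf` is the tree `|` (one edge, no internal vertex);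
`node [t₁, …, tₘ]` is `(t₁ ⊔ ⋯ ⊔ tₘ) · 𝔱ₘ`: its lowest internal vertex has, from left to right, the
subtrees `t₁, …, tₘ` above it. -/
inductive PlaneTree : Type
  | leaf : PlaneTree
  | node : List PlaneTree → PlaneTree

namespace PlaneTree

/-- Every internal vertex `v` has at least two edges going up, i.e. `Card E_v ≥ 3`. -/
inductive Reduced : PlaneTree → Prop
  | leaf : Reduced leaf
  | node (ts : List PlaneTree) (h2 : 2 ≤ ts.length) (h : ∀ t ∈ ts, Reduced t) : Reduced (node ts)

mutual
/-- The number of input vertices. -/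
def leaves : PlaneTree → ℕ
  | leaf => 1
  | node ts => forestLeaves ts
/-- The number of input vertices of a forest. -/
def forestLeaves : List PlaneTree → ℕ
  | [] => 0
  | t :: ts => leaves t + forestLeaves ts
end

mutual
/-- `|t|`, the number of internal vertices. -/
def size : PlaneTree → ℕ
  | leaf => 0
  | node ts => 1 + forestSize ts
/-- The number of internal vertices of a forest. -/
def forestSize : List PlaneTree → ℕ
  | [] => 0
  | t :: ts => size t + forestSize ts
end

/-- `ContractsTo t' h t` says: contracting in `t'` the edge `e` whose endpoints are internal vertices
and whose highest vertex has height `h` gives `t`.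

Heights are taken in the linearly ordered tree `t'_<`: a vertex precedes the vertices above it, and
of two incomparable vertices the one on the left comes first. So the lowest vertex of
`node [t₁, …, tₘ]` has height `1`, and the vertex of height `h` in `t_p` has height
`1 + |t₁| + ⋯ + |t_{p-1}| + h` in `node [t₁, …, tₘ]`. -/
inductive ContractsTo : PlaneTree → ℕ → PlaneTree → Prop
  | root (l m r : List PlaneTree) :
      ContractsTo (node (l ++ node m :: r)) (1 + forestSize l + 1) (node (l ++ m ++ r))
  | above (l r : List PlaneTree) {t' t : PlaneTree} {h : ℕ} (H : ContractsTo t' h t) :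
      ContractsTo (node (l ++ t' :: r)) (1 + forestSize l + h) (node (l ++ t :: r))

theorem forestLeaves_append (l r : List PlaneTree) :
    forestLeaves (l ++ r) = forestLeaves l + forestLeaves r := by
  induction l with
  | nil => simp [forestLeaves]
  | cons t l ih => simp [forestLeaves, ih, Nat.add_assoc]

theorem forestSize_append (l r : List PlaneTree) :
    forestSize (l ++ r) = forestSize l + forestSize r := by
  induction l with
  | nil => simp [forestSize]
  | cons t l ih => simp [forestSize, ih, Nat.add_assoc]

theorem ContractsTo.leaves_eq {t' t : PlaneTree} {h : ℕ} (H : ContractsTo t' h t) :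
    t'.leaves = t.leaves := by
  induction H with
  | root l m r => simp [leaves, forestLeaves_append, forestLeaves]
  | above l r H ih => simp [leaves, forestLeaves_append, forestLeaves, ih]

theorem ContractsTo.size_eq {t' t : PlaneTree} {h : ℕ} (H : ContractsTo t' h t) :
    t'.size = t.size + 1 := by
  induction H with
  | root l m r => simp [size, forestSize_append, forestSize]; omega
  | above l r H ih => simp [size, forestSize_append, forestSize, ih]; omega

theorem finite_splits (ts : List PlaneTree) :
    {p : List PlaneTree × List PlaneTree | p.1 ++ p.2 = ts}.Finite := by
  refine Set.Finite.subset (Set.Finite.image (fun n => (ts.take n, ts.drop n))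
    (Set.finite_Iic ts.length)) ?_
  rintro ⟨l, r⟩ h
  refine ⟨l.length, ?_, ?_⟩
  · simp only [Set.mem_Iic]
    rw [← show l ++ r = ts from h]; simp
  · rw [← show l ++ r = ts from h]; simp

theorem finite_contractsTo : ∀ t : PlaneTree,
    {p : PlaneTree × ℕ | ContractsTo p.1 p.2 t}.Finite
  | leaf => by
      refine Set.Finite.subset Set.finite_empty ?_
      rintro ⟨t', h⟩ H
      cases H
  | node ts => by
      have h1 : {q : (List PlaneTree × List PlaneTree) × (List PlaneTree × List PlaneTree) |
          q.1 ∈ {p : List PlaneTree × List PlaneTree | p.1 ++ p.2 = ts} ∧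
          q.2 ∈ {p : List PlaneTree × List PlaneTree | p.1 ++ p.2 = q.1.1}}.Finite := by
        refine Set.Finite.subset ((finite_splits ts).biUnion (fun p _ =>
          (finite_splits p.1).image (fun q => (p, q)))) ?_
        rintro ⟨p, q⟩ ⟨hp, hq⟩
        simp only [Set.mem_iUnion]
        exact ⟨p, hp, q, hq, rfl⟩
      have h2 : ∀ s ∈ ts, {p : PlaneTree × ℕ | ContractsTo p.1 p.2 s}.Finite :=
        fun s hs => finite_contractsTo s
      have h2' : (⋃ s ∈ {s | s ∈ ts}, {p : PlaneTree × ℕ | ContractsTo p.1 p.2 s}).Finite :=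
        (List.finite_toSet ts).biUnion h2
      refine Set.Finite.subset (((h1.image (fun q =>
        (node (q.2.1 ++ node q.2.2 :: q.1.2), 1 + forestSize q.2.1 + 1)))).union
        (((finite_splits ts).prod h2').image (fun q =>
        (node (q.1.1 ++ q.2.1 :: q.1.2.tail), 1 + forestSize q.1.1 + q.2.2)))) ?_
      rintro ⟨t', h⟩ H
      simp only [Set.mem_ofPred_eq] at H
      generalize hs : node ts = s at H
      cases H with
      | root l m r =>
        left
        injection hs with hs
        exact ⟨((l ++ m, r), (l, m)), ⟨hs.symm, rfl⟩, rfl⟩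
      | @above l r t' t h H =>
        right
        injection hs with hs
        refine ⟨((l, t :: r), (t', h)), ⟨hs.symm, ?_⟩, rfl⟩
        simp only [Set.mem_iUnion]
        exact ⟨t, by simp [hs], H⟩
termination_by t => sizeOf t

/-- All pairs `(t', h)` where `t'` is a plane rooted tree with `Card E_v ≥ 3` for all internal
vertices `v`, together with a distinguished edge `e` (recorded by the height `h` of its highest
vertex) whose contraction gives `t`. -/
noncomputable def edgeInsertions (t : PlaneTree) : Finset (PlaneTree × ℕ) :=
  (show {p : PlaneTree × ℕ | p.1.Reduced ∧ ContractsTo p.1 p.2 t}.Finite from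
    (finite_contractsTo t).subset fun _ h => h.2).toFinset

theorem mem_edgeInsertions {t : PlaneTree} {p : PlaneTree × ℕ} :
    p ∈ t.edgeInsertions ↔ p.1.Reduced ∧ ContractsTo p.1 p.2 t := by
  simp [edgeInsertions]

end PlaneTree

/-! ### Differential graded quivers and their tensor powers -/

/-- A differential graded `k`-quiver (differentials have degree `+1`). -/
structure DGQuiver (k : Type u) [CommRing k] where
  Obj : Type v
  Hom : Obj → Obj → CochainComplex (ModuleCat.{u} k) ℤ

/-- The complex `sQ(X,Y) = Q(X,Y)[1]`. -/
noncomputable abbrev DGQuiver.sHom {k : Type u} [CommRing k] (Q : DGQuiver.{u, v} k)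
    (X Y : Q.Obj) : CochainComplex (ModuleCat.{u} k) ℤ :=
  (shiftFunctor (CochainComplex (ModuleCat.{u} k) ℤ) (1 : ℤ)).obj (Q.Hom X Y)

/-- The indices of the summands of `TsQ(X,Y)`: objects `X = X₀, X₁, …, Xₙ = Y` and degrees
`i₁, …, iₙ`. -/
inductive Word {k : Type u} [CommRing k] (Q : DGQuiver.{u, v} k) : Q.Obj → Q.Obj → Type v
  | nil (X : Q.Obj) : Word Q X X
  | cons {X Y Z : Q.Obj} (i : ℤ) (w : Word Q Y Z) : Word Q X Z

namespace Word

variable {k : Type u} [CommRing k] {Q : DGQuiver.{u, v} k}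

def length : {X Y : Q.Obj} → Word Q X Y → ℕ
  | _, _, nil _ => 0
  | _, _, cons _ w => w.length + 1

/-- `i₁ + ⋯ + iₙ`. -/
def degree : {X Y : Q.Obj} → Word Q X Y → ℤ
  | _, _, nil _ => 0
  | _, _, cons i w => i + w.degree

def append : {X Y Z : Q.Obj} → Word Q X Y → Word Q Y Z → Word Q X Z
  | _, _, _, nil _, w' => w'
  | _, _, _, cons i w, w' => cons i (w.append w')

/-- Raise the degree at position `j` (counted from `0`) by one. -/
def bump : {X Y : Q.Obj} → Word Q X Y → ℕ → Word Q X Y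
  | _, _, nil X, _ => nil X
  | _, _, cons i w, 0 => cons (i + 1) w
  | _, _, cons i w, j + 1 => cons i (w.bump j)

theorem length_append {X Y Z : Q.Obj} (w : Word Q X Y) (w' : Word Q Y Z) :
    (w.append w').length = w.length + w'.length := by
  induction w with
  | nil => simp [append, length]
  | cons i w ih => simp only [append, length, ih]; omega

theorem length_bump {X Y : Q.Obj} (w : Word Q X Y) (j : ℕ) : (w.bump j).length = w.length := by
  induction w generalizing j with
  | nil => rfl
  | cons i w ih => cases j <;> simp [bump, length, ih]

/-- `sQ(X₀,X₁)^{i₁} ⊗ ⋯ ⊗ sQ(X_{n-1},Xₙ)^{iₙ}` (bracketed to the right, ending in `k`). -/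
noncomputable def tensor : {X Y : Q.Obj} → Word Q X Y → ModuleCat.{u} k
  | _, _, nil _ => ModuleCat.of k k
  | X, _, @cons _ _ _ _ Y _ i w => ModuleCat.of k ((Q.sHom X Y).X i ⊗[k] w.tensor)

/-- The canonical isomorphism concatenating tensors. -/
noncomputable def concat : {X Y Z : Q.Obj} → (w : Word Q X Y) → (w' : Word Q Y Z) →
    (w.tensor ⊗[k] w'.tensor) ≃ₗ[k] (w.append w').tensor
  | _, _, _, nil _, w' => TensorProduct.lid k w'.tensor
  | X, _, _, @cons _ _ _ _ Y _ i w, w' =>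
      (TensorProduct.assoc k ((Q.sHom X Y).X i) w.tensor w'.tensor).trans
        (TensorProduct.congr (LinearEquiv.refl k ((Q.sHom X Y).X i)) (w.concat w'))

/-- `1^{⊗j} ⊗ d ⊗ 1^{⊗(n-1-j)}` with `d` the differential of `sQ`. On `x ⊗ y` one has
`(x ⊗ y)(d ⊗ 1) = (-1)^{deg y} xd ⊗ y` and `(x ⊗ y)(1 ⊗ f) = x ⊗ yf`. -/
noncomputable def dAt : {X Y : Q.Obj} → (w : Word Q X Y) → (j : ℕ) →
    w.tensor →ₗ[k] (w.bump j).tensor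
  | _, _, nil _, _ => 0
  | X, _, @cons _ _ _ _ Y _ i w, 0 =>
      w.degree.negOnePow •
        TensorProduct.map ((Q.sHom X Y).d i (i + 1)).hom (LinearMap.id (M := w.tensor))
  | X, _, @cons _ _ _ _ Y _ i w, j + 1 =>
      TensorProduct.map (LinearMap.id (M := (Q.sHom X Y).X i)) (w.dAt j)

end Word

/-! ### The graded quiver `FQ` -/

section Free

variable {k : Type u} [CommRing k] (Q : DGQuiver.{u, v} k)

/-- The indices of the summands of `sFQ(X,Y)`: for some `n ≥ 1`, a plane rooted tree `t` with `n`
input vertices and `Card E_v ≥ 3` for all internal vertices `v`, objects `X = X₀, …, Xₙ = Y` and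
degrees `i₁, …, iₙ`. -/
@[ext] structure TreeIndex (X Y : Q.Obj) where
  tree : PlaneTree
  word : Word Q X Y
  reduced : tree.Reduced
  length_eq : word.length = tree.leaves

/-- The underlying `k`-module of `sFQ(X,Y)` and of `FQ(X,Y)`, the direct sum of the modules
`sQ(X₀,X₁)^{i₁} ⊗ ⋯ ⊗ sQ(X_{n-1},Xₙ)^{iₙ}` over all trees `t`, objects and degrees. -/
abbrev FreeHom (X Y : Q.Obj) : Type (max u v) :=
  DirectSum (TreeIndex Q X Y) (fun p => p.word.tensor)

variable {Q}

/-- The degree of a summand in `sFQ(X,Y)`: the shift `[-|t|]` adds `|t|` to the degree in the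
tensor product. -/
def TreeIndex.sDegree {X Y : Q.Obj} (p : TreeIndex Q X Y) : ℤ :=
  p.word.degree + p.tree.size

variable (Q) in
/-- The degree `d` part of `FQ(X,Y)`, that is, the degree `d - 1` part of `sFQ(X,Y)`. -/
def freeDeg (X Y : Q.Obj) (d : ℤ) : Submodule k (FreeHom Q X Y) where
  carrier := {f | ∀ p : TreeIndex Q X Y, p.sDegree ≠ d - 1 → f p = 0}
  add_mem' := fun {f g} hf hg p hp => by
    rw [DirectSum.add_apply, hf p hp, hg p hp, add_zero]
  zero_mem' := fun p _ => rfl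
  smul_mem' := fun a f hf p hp => by
    rw [DirectSum.smul_apply, hf p hp, smul_zero]

theorem freeDeg_isInternal (X Y : Q.Obj) : DirectSum.IsInternal (freeDeg Q X Y) := by
  classical
  apply DirectSum.isInternal_submodule_of_iSupIndep_of_iSup_eq_top
  · rw [iSupIndep_def]
    intro d
    let B : Submodule k (FreeHom Q X Y) :=
      { carrier := {f | ∀ p : TreeIndex Q X Y, p.sDegree = d - 1 → f p = 0}
        add_mem' := fun {f g} hf hg p hp => by
          rw [DirectSum.add_apply, hf p hp, hg p hp, add_zero]
        zero_mem' := fun p _ => rfl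
        smul_mem' := fun a f hf p hp => by rw [DirectSum.smul_apply, hf p hp, smul_zero] }
    have hB : (⨆ j, ⨆ (_ : j ≠ d), freeDeg Q X Y j) ≤ B := by
      refine iSup_le fun j => iSup_le fun hj f hf p hp => hf p ?_
      omega
    refine Disjoint.mono_right hB ?_
    rw [Submodule.disjoint_def]
    intro f hf hf'
    refine DFinsupp.ext fun p => ?_
    by_cases hp : p.sDegree = d - 1
    · exact hf' p hp
    · exact hf p hp
  · rw [eq_top_iff]
    rintro f -
    induction f using DirectSum.induction_on with
    | zero => exact Submodule.zero_mem _
    | add f g hf hg => exact Submodule.add_mem _ hf hg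
    | of p x =>
      refine Submodule.mem_iSup_of_mem (p.sDegree + 1) fun q hq => ?_
      refine DirectSum.of_eq_of_ne _ _ _ ?_
      rintro rfl
      omega

variable (Q) in
/-- The graded `k`-quiver `FQ`. -/
noncomputable def freeQuiver : GradedQuiver.{u, v, max u v} k where
  Obj := Q.Obj
  Hom := FreeHom Q
  deg := freeDeg Q
  isInternal := freeDeg_isInternal

/-! ### The operations of `FQ` -/

/-- The inclusion of a summand. -/
noncomputable def treeIncl {X Y : Q.Obj} (p : TreeIndex Q X Y) :
    p.word.tensor →ₗ[k] FreeHom Q X Y := by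
  classical exact DirectSum.lof k (TreeIndex Q X Y) (fun p => p.word.tensor) p

/-- The summand with the same tree and the degree at position `j` raised by one. -/
def TreeIndex.bump {X Y : Q.Obj} (p : TreeIndex Q X Y) (j : ℕ) : TreeIndex Q X Y where
  tree := p.tree
  word := p.word.bump j
  reduced := p.reduced
  length_eq := (p.word.length_bump j).trans p.length_eq

/-- The summand with the same objects and degrees and a tree `t'` obtained by inserting an edge. -/
def TreeIndex.insert {X Y : Q.Obj} (p : TreeIndex Q X Y) (e : PlaneTree × ℕ)
    (he : e ∈ p.tree.edgeInsertions) : TreeIndex Q X Y where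
  tree := e.1
  word := p.word
  reduced := (PlaneTree.mem_edgeInsertions.1 he).1
  length_eq := p.length_eq.trans (PlaneTree.mem_edgeInsertions.1 he).2.leaves_eq.symm

/-- The operation `b₁` on the summand `p`, with tree `t`.

First line: `d ⊗ 1 ⊗ ⋯ ⊗ 1 + ⋯ + 1 ⊗ ⋯ ⊗ 1 ⊗ d`, where the last `d` is the differential
`(-1)^{|t|} s^{|t|} d s^{-|t|}` of `sQ[-|t|]`. As the degree of the last factor in `sQ[-|t|]` is `|t|`
more than that in `sQ`, each summand differs by the factor `(-1)^{|t|}` from the corresponding one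
for the complex `sQ`.

Second line: the sum of `(-1)^{β(t',e)} s^{-1}` over all `(t', e)` whose contraction gives `t`, with
`β(t',e) = 1 + h` where `h` is the height of the highest vertex of `e`; the map `s^{-1}`, which is
`1^{⊗(n-1)} ⊗ s^{-1}`, is the identity on elements. -/
noncomputable def b₁On {X Y : Q.Obj} (p : TreeIndex Q X Y) :
    p.word.tensor →ₗ[k] FreeHom Q X Y :=
  (∑ j ∈ Finset.range p.word.length,
    (p.tree.size : ℤ).negOnePow • (treeIncl (p.bump j) ∘ₗ p.word.dAt j)) +
  ∑ e ∈ p.tree.edgeInsertions.attach,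
    (1 + (e.1.2 : ℤ)).negOnePow • treeIncl (p.insert e.1 e.2)

/-- The operation `b₁ : sFQ(X,Y) → sFQ(X,Y)`. -/
noncomputable def b₁ {X Y : Q.Obj} : FreeHom Q X Y →ₗ[k] FreeHom Q X Y := by
  classical exact DirectSum.toModule k (TreeIndex Q X Y) (FreeHom Q X Y) b₁On

variable (Q) in
/-- The analogue of `TreeIndex` for forests `t₁ ⊔ ⋯ ⊔ tₘ`, `m ≥ 0`. -/
@[ext] structure ForestIndex (X Y : Q.Obj) where
  forest : List PlaneTree
  word : Word Q X Y
  reduced : ∀ t ∈ forest, t.Reduced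
  length_eq : word.length = PlaneTree.forestLeaves forest

/-- The sum of the degrees in `sF_{t₁}Q, …, sF_{tₘ}Q` of the parts of the word. -/
def ForestIndex.sDegree {X Y : Q.Obj} (q : ForestIndex Q X Y) : ℤ :=
  q.word.degree + PlaneTree.forestSize q.forest

def ForestIndex.nil (X : Q.Obj) : ForestIndex Q X X where
  forest := []
  word := .nil X
  reduced := by simp
  length_eq := rfl

def ForestIndex.cons {X Y Z : Q.Obj} (p : TreeIndex Q X Y) (q : ForestIndex Q Y Z) :
    ForestIndex Q X Z where
  forest := p.tree :: q.forest
  word := p.word.append q.word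
  reduced := by
    intro t ht
    rcases List.mem_cons.1 ht with rfl | ht
    · exact p.reduced
    · exact q.reduced t ht
  length_eq := by
    rw [Word.length_append, p.length_eq, q.length_eq, PlaneTree.forestLeaves]

/-- `t₁ ⊔ ⋯ ⊔ tₘ ↦ (t₁ ⊔ ⋯ ⊔ tₘ) · 𝔱ₘ`, for `m ≥ 2`. -/
def ForestIndex.graft {X Y : Q.Obj} (q : ForestIndex Q X Y) (h : 2 ≤ q.forest.length) :
    TreeIndex Q X Y where
  tree := .node q.forest
  word := q.word
  reduced := .node _ h q.reduced
  length_eq := q.length_eq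

variable (Q) in
/-- The direct sum over all forests, objects and degrees of the modules
`sQ(X₀,X₁)^{i₁} ⊗ ⋯ ⊗ sQ(X_{n-1},Xₙ)^{iₙ}`. -/
abbrev ForestHom (X Y : Q.Obj) : Type (max u v) :=
  DirectSum (ForestIndex Q X Y) (fun q => q.word.tensor)

/-- The inclusion of a summand. -/
noncomputable def forestIncl {X Y : Q.Obj} (q : ForestIndex Q X Y) :
    q.word.tensor →ₗ[k] ForestHom Q X Y := by
  classical exact DirectSum.lof k (ForestIndex Q X Y) (fun q => q.word.tensor) q

/-- On `x ∈ sF_{t₁}Q` and `y ∈ sF_{t₂}Q ⊗ ⋯ ⊗ sF_{tₘ}Q` this is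
`x ⊗ y ↦ (x ⊗ y)(s^{|t₁|} ⊗ 1) = (-1)^{|t₁| deg y} x s^{|t₁|} ⊗ y`. -/
noncomputable def consForest {X Y Z : Q.Obj} :
    FreeHom Q X Y →ₗ[k] ForestHom Q Y Z →ₗ[k] ForestHom Q X Z := by
  classical exact
  DirectSum.toModule k (TreeIndex Q X Y) (ForestHom Q Y Z →ₗ[k] ForestHom Q X Z) fun p =>
    LinearMap.flip (DirectSum.toModule k (ForestIndex Q Y Z) (p.word.tensor →ₗ[k] ForestHom Q X Z)
      fun q => LinearMap.flip (((p.tree.size : ℤ) * q.sDegree).negOnePow •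
        TensorProduct.curry
          (forestIncl (ForestIndex.cons p q) ∘ₗ (p.word.concat q.word).toLinearMap)))

/-- `(x₁, …, xₘ) ↦ (x₁ ⊗ ⋯ ⊗ xₘ)(s^{|t₁|} ⊗ ⋯ ⊗ s^{|tₘ|})` for `xⱼ ∈ sF_{tⱼ}Q`. -/
noncomputable def toForest : {X Y : (freeQuiver Q).Obj} → Chain (freeQuiver Q) X Y →
    ForestHom Q X Y
  | _, _, .nil X => forestIncl (ForestIndex.nil X) (1 : k)
  | _, _, .cons x c => consForest x (toForest c)

/-- Grafting forests `t₁ ⊔ ⋯ ⊔ tₘ`, `m ≥ 2`, onto the corolla `𝔱ₘ`. On elements this is the map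
`1 ⊗ ⋯ ⊗ 1 ⊗ s^{-|t|}` with `t = (t₁ ⊔ ⋯ ⊔ tₘ) · 𝔱ₘ`. -/
noncomputable def graft {X Y : Q.Obj} : ForestHom Q X Y →ₗ[k] FreeHom Q X Y := by
  classical exact
  DirectSum.toModule k (ForestIndex Q X Y) (FreeHom Q X Y) fun q =>
    if h : 2 ≤ q.forest.length then treeIncl (q.graft h) else 0

/-- The operations `bₙ` of `FQ`: `b₁` is as above, and for `n > 1` the operation `bₙ` is the sum of
the maps `s^{|t₁|} ⊗ ⋯ ⊗ s^{|t_{n-1}|} ⊗ s^{|tₙ| - |t|}` from `sF_{t₁}Q ⊗ ⋯ ⊗ sF_{tₙ}Q` to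
`sF_tQ` with `t = (t₁ ⊔ ⋯ ⊔ tₙ) · 𝔱ₙ`. -/
noncomputable def freeB : {X Y : (freeQuiver Q).Obj} → Chain (freeQuiver Q) X Y →
    (freeQuiver Q).Hom X Y
  | _, _, .nil _ => (0 : FreeHom Q _ _)
  | _, _, .cons x (.nil _) => b₁ x
  | _, _, .cons x (.cons y c) => graft (toForest (.cons x (.cons y c)))

end Free

end FreeAInf

-- Without the shifts, every summand `sF_tQ` is the part of the tensor quiver `TsQ` with as many
-- factors as `t` has inputs, and `TsQ` is a differential graded category under concatenation. On a
-- sequence whose entries lie in single summands (`IsElementary`), `bₙ` with `n ≥ 2` is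
-- concatenation in `TsQ`, followed by relabelling with the grafted tree (`treeOf`) and a Koszul
-- sign; `b₁` is, up to signs, the differential of `TsQ` plus the insertion of an edge into the
-- tree. Both sides of the equations are additive in each entry, so elementary sequences suffice
-- (`mem_of_isElementary`), and the equations become identities between signed sums over trees.
--
-- For one entry the equation is `b₁² = 0`. The differential squares to zero. It cancels against a
-- single insertion because an insertion raises `|t|`, hence the sign of the differential, by one.
-- Double insertions cancel in pairs: exchanging the order in which two edges are inserted moves one
-- of the two heights by one. The combinatorics rests on the remark that contracting an edge deletes
-- its highest vertex (`contractsTo_iff`); such deletions satisfy a simplicial identity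
-- (`removeVertex_comm`).
--
-- For `m ≥ 2` entries, `bₘ` followed by `b₁` gives the differential of the product and all
-- insertions into `t = (t₁ ⊔ ⋯ ⊔ tₘ) · 𝔱ₘ`. By the Leibniz rule (`diff_eq_sum`) the former matches
-- the differentials in `b₁` of the single entries. By `sum_edgeInsertions_node` an insertion into
-- `t` either takes place inside one `tⱼ`, which is the remaining part of `b₁` of that entry, or
-- gathers consecutive `tⱼ` under a new vertex, which is an inner `bₙ` with `1 < n < m`. So each
-- term occurs twice; that the signs are opposite follows from `freeB_freeB_inner`,
-- `freeB_freeB_join` and `freeB_freeB_outer`.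

namespace FreeAInf

-- The differential graded category `TsQ`

section TensorCategory

variable {k : Type u} [CommRing k] {Q : DGQuiver.{u, v} k}

namespace Word

/-- The empty tensor. -/
def unit (X : Q.Obj) : (nil X : Word Q X X).tensor := (1 : k)

/-- The tensor `a ⊗ x`. -/
noncomputable def tmul {X Y Z : Q.Obj} {i : ℤ} (a : (Q.sHom X Y).X i) (w : Word Q Y Z) :
    w.tensor →ₗ[k] (cons i w : Word Q X Z).tensor :=
  TensorProduct.mk k ((Q.sHom X Y).X i) w.tensor a

theorem concat_unit {X Y : Q.Obj} (w : Word Q X Y) (x : w.tensor) :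
    (nil X).concat w (unit X ⊗ₜ[k] x) = x :=
  (TensorProduct.lid_tmul x (1 : k)).trans (one_smul k x)

theorem tmul_zero_left {X Y Z : Q.Obj} {i : ℤ} (w : Word Q Y Z) :
    tmul (0 : (Q.sHom X Y).X i) w = 0 :=
  map_zero (TensorProduct.mk k ((Q.sHom X Y).X i) w.tensor)

theorem tensor_nil_induction {X : Q.Obj} {P : (nil X : Word Q X X).tensor → Prop}
    (h : ∀ a : k, P (a • unit X)) (x : (nil X : Word Q X X).tensor) : P x := by
  exact (congrArg P (show (show k from x) • unit X = x from @_root_.mul_one k _ x)).mp (h x)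

theorem tensor_cons_induction {X Y Z : Q.Obj} {i : ℤ} {w : Word Q Y Z}
    {P : (cons i w : Word Q X Z).tensor → Prop} (zero : P 0)
    (add : ∀ x y, P x → P y → P (x + y))
    (tmul : ∀ a x, P (tmul a w x)) (x : (cons i w : Word Q X Z).tensor) : P x :=
  TensorProduct.induction_on x zero tmul add

end Word

/-- The tensor quiver `TsQ(X,Y)`, the direct sum of all words from `X` to `Y`. -/
abbrev TensorHom (Q : DGQuiver.{u, v} k) (X Y : Q.Obj) : Type (max u v) :=
  DirectSum (Word Q X Y) (fun w => w.tensor)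

namespace TensorHom

/-- The inclusion of a summand. -/
noncomputable def incl {X Y : Q.Obj} (w : Word Q X Y) : w.tensor →ₗ[k] TensorHom Q X Y := by
  classical exact DirectSum.lof k (Word Q X Y) (fun w => w.tensor) w

/-- The linear map out of `TsQ(X,Y)` with the given components. -/
noncomputable def lift {X Y : Q.Obj} {M : Type*} [AddCommGroup M] [Module k M]
    (f : ∀ w : Word Q X Y, w.tensor →ₗ[k] M) : TensorHom Q X Y →ₗ[k] M := by
  classical exact DirectSum.toModule k (Word Q X Y) M f

@[simp] theorem lift_incl {X Y : Q.Obj} {M : Type*} [AddCommGroup M] [Module k M]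
    (f : ∀ w : Word Q X Y, w.tensor →ₗ[k] M) (w : Word Q X Y) (x : w.tensor) :
    lift f (incl w x) = f w x := by
  classical exact DirectSum.toModule_lof (M := fun w : Word Q X Y => (w.tensor : Type u)) (φ := f) k w x

theorem hom_ext {X Y : Q.Obj} {M : Type*} [AddCommGroup M] [Module k M]
    {f g : TensorHom Q X Y →ₗ[k] M} (h : ∀ w x, f (incl w x) = g (incl w x)) : f = g := by
  classical
  exact DirectSum.linearMap_ext k fun w => LinearMap.ext fun x => h w x

/-- Concatenation of tensors. -/
noncomputable def mul {X Y Z : Q.Obj} :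
    TensorHom Q X Y →ₗ[k] TensorHom Q Y Z →ₗ[k] TensorHom Q X Z :=
  lift fun w => LinearMap.flip (lift fun w' => LinearMap.flip
    (TensorProduct.curry (incl (w.append w') ∘ₗ (w.concat w').toLinearMap)))

theorem mul_incl {X Y Z : Q.Obj} (w : Word Q X Y) (w' : Word Q Y Z) (x : w.tensor)
    (y : w'.tensor) :
    mul (incl w x) (incl w' y) = incl (w.append w') (w.concat w' (x ⊗ₜ y)) := by
  simp [mul]

/-- The unit of `TsQ`. -/
noncomputable def one (X : Q.Obj) : TensorHom Q X X := incl (.nil X) (Word.unit X)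

/-- Concatenation with a single homogeneous element on the left. -/
noncomputable def consL {X Y : Q.Obj} (Z : Q.Obj) {i : ℤ} (a : (Q.sHom X Y).X i) :
    TensorHom Q Y Z →ₗ[k] TensorHom Q X Z :=
  lift fun w => incl (.cons i w) ∘ₗ Word.tmul a w

theorem consL_incl {X Y Z : Q.Obj} {i : ℤ} (a : (Q.sHom X Y).X i) (w : Word Q Y Z)
    (x : w.tensor) : consL Z a (incl w x) = incl (.cons i w) (Word.tmul a w x) := by
  simp [consL]

theorem one_mul {X Y : Q.Obj} (y : TensorHom Q X Y) : mul (one X) y = y := by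
  have : mul (one X) = (LinearMap.id : TensorHom Q X Y →ₗ[k] TensorHom Q X Y) := by
    refine hom_ext fun w x => ?_
    rw [one, mul_incl, Word.concat_unit]
    rfl
  rw [this]; rfl

theorem consL_mul {X Y Z W : Q.Obj} {i : ℤ} (a : (Q.sHom X Y).X i) (x : TensorHom Q Y Z)
    (y : TensorHom Q Z W) : mul (consL Z a x) y = consL W a (mul x y) := by
  have : mul ∘ₗ consL Z a = (LinearMap.llcomp k _ _ _ (consL W a)) ∘ₗ mul := by
    refine hom_ext fun w x => hom_ext fun w' y => ?_
    simp only [LinearMap.comp_apply, LinearMap.llcomp_apply, mul_incl, consL_incl]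
    rfl
  exact LinearMap.congr_fun (LinearMap.congr_fun this x) y

/-- Linear maps out of `TsQ` agree if they agree on units and on elements `a ⊗ x`. -/
theorem induction {Y : Q.Obj} {P : ∀ {X : Q.Obj}, TensorHom Q X Y → Prop}
    (zero : ∀ {X}, P (0 : TensorHom Q X Y))
    (add : ∀ {X} (x y : TensorHom Q X Y), P x → P y → P (x + y))
    (unit : ∀ a : k, P (a • one Y))
    (cons : ∀ {X Z : Q.Obj} {i : ℤ} (a : (Q.sHom X Z).X i) (w : Word Q Z Y) (x : w.tensor),
      P (incl w x) → P (consL Y a (incl w x))) {X : Q.Obj} (x : TensorHom Q X Y) : P x := by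
  classical
  induction x using DirectSum.induction_on with
  | zero => exact zero
  | add x y hx hy => exact add x y hx hy
  | of w x =>
    change P (incl w x)
    induction w with
    | nil X =>
      induction x using Word.tensor_nil_induction with
      | h a => rw [map_smul]; exact unit a
    | cons i w ih =>
      induction x using Word.tensor_cons_induction with
      | zero => rw [map_zero]; exact zero
      | add x y hx hy => rw [map_add]; exact add _ _ hx hy
      | tmul a x => rw [← consL_incl]; exact cons a w x (ih zero add unit cons x)

theorem mul_one {X Y : Q.Obj} (x : TensorHom Q X Y) : mul x (one Y) = x := by
  induction x using induction with
  | zero => simp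
  | add x y hx hy => rw [map_add, LinearMap.add_apply, hx, hy]
  | unit a => rw [map_smul, LinearMap.smul_apply, one_mul]
  | cons a w x ih => rw [consL_mul, ih]

theorem mul_assoc {X Y Z W : Q.Obj} (x : TensorHom Q X Y) (y : TensorHom Q Y Z)
    (z : TensorHom Q Z W) : mul (mul x y) z = mul x (mul y z) := by
  induction x using induction with
  | zero => simp
  | add x y hx hy => simp only [map_add, LinearMap.add_apply, hx, hy]
  | unit a => simp only [map_smul, LinearMap.smul_apply, one_mul]
  | cons a w x ih => simp only [consL_mul, ih]

/-- The involution acting as `(-1)^d` in degree `d`. -/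
noncomputable def sign {X Y : Q.Obj} : TensorHom Q X Y →ₗ[k] TensorHom Q X Y :=
  lift fun w => w.degree.negOnePow • incl w

theorem sign_incl {X Y : Q.Obj} (w : Word Q X Y) (x : w.tensor) :
    sign (incl w x) = w.degree.negOnePow • incl w x := by
  simp [sign]

theorem sign_one (X : Q.Obj) : sign (one X) = (one X : TensorHom Q X X) := by
  rw [one, sign_incl]; simp [Word.degree]

/-- The differential of `TsQ`. -/
noncomputable def diff {X Y : Q.Obj} : TensorHom Q X Y →ₗ[k] TensorHom Q X Y :=
  lift fun w => ∑ j ∈ Finset.range w.length, incl (w.bump j) ∘ₗ w.dAt j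

theorem diff_incl {X Y : Q.Obj} (w : Word Q X Y) (x : w.tensor) :
    diff (incl w x) = ∑ j ∈ Finset.range w.length, incl (w.bump j) (w.dAt j x) := by
  simp [diff]

theorem diff_one (X : Q.Obj) : diff (one X) = (0 : TensorHom Q X X) := by
  rw [one, diff_incl]; rfl

theorem smul_units {M : Type*} [AddCommGroup M] [Module k M] {N : Type*} [AddCommGroup N]
    [Module k N] (f : M →ₗ[k] N) (s : ℤˣ) (x : M) : f (s • x) = s • f x := by
  simp only [Units.smul_def, map_zsmul]

theorem sign_consL {X Y Z : Q.Obj} {i : ℤ} (a : (Q.sHom X Y).X i) (x : TensorHom Q Y Z) :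
    sign (consL Z a x) = i.negOnePow • consL Z a (sign x) := by
  have : sign ∘ₗ consL Z a = i.negOnePow • (consL Z a ∘ₗ sign) := by
    refine hom_ext fun w x => ?_
    simp only [LinearMap.comp_apply, LinearMap.smul_apply, consL_incl, sign_incl, smul_units,
      smul_smul, Word.degree, Int.negOnePow_add]
  exact LinearMap.congr_fun this x

theorem incl_dAt_zero {X Y Z : Q.Obj} {i : ℤ} (a : (Q.sHom X Y).X i) (w : Word Q Y Z)
    (x : w.tensor) :
    incl ((Word.cons i w).bump 0) ((Word.cons i w).dAt 0 (Word.tmul a w x)) =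
      w.degree.negOnePow •
        incl (.cons (i + 1) w) (Word.tmul (((Q.sHom X Y).d i (i + 1)).hom a) w x) := by
  rw [← smul_units]
  rfl

theorem incl_dAt_succ {X Y Z : Q.Obj} {i : ℤ} (a : (Q.sHom X Y).X i) (w : Word Q Y Z)
    (x : w.tensor) (j : ℕ) :
    incl ((Word.cons i w).bump (j + 1)) ((Word.cons i w).dAt (j + 1) (Word.tmul a w x)) =
      incl (.cons i (w.bump j)) (Word.tmul a (w.bump j) (w.dAt j x)) :=
  rfl

/-- Position `0` gives the term with `sign`, since an operator written on the right passes all later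
factors; the remaining positions are those of the tail, moved by one. -/
theorem diff_consL {X Y Z : Q.Obj} {i : ℤ} (a : (Q.sHom X Y).X i) (x : TensorHom Q Y Z) :
    diff (consL Z a x) = consL Z a (diff x) +
      consL Z (((Q.sHom X Y).d i (i + 1)).hom a) (sign x) := by
  have : diff ∘ₗ consL Z a = consL Z a ∘ₗ diff +
      consL Z (((Q.sHom X Y).d i (i + 1)).hom a) ∘ₗ sign := by
    refine hom_ext fun w x => ?_
    simp only [LinearMap.comp_apply, LinearMap.add_apply, consL_incl, sign_incl, smul_units,
      diff_incl, Word.length, Finset.sum_range_succ', map_sum, incl_dAt_zero,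
      incl_dAt_succ]
  exact LinearMap.congr_fun this x

theorem sign_mul {X Y Z : Q.Obj} (x : TensorHom Q X Y) (y : TensorHom Q Y Z) :
    sign (mul x y) = mul (sign x) (sign y) := by
  induction x using induction with
  | zero => simp
  | add x y hx hy => simp only [map_add, LinearMap.add_apply, hx, hy]
  | unit a => simp only [map_smul, LinearMap.smul_apply, one_mul, sign_one]
  | cons a w x ih =>
    simp only [consL_mul, sign_consL, ih, Units.smul_def, map_zsmul,
      LinearMap.smul_apply]

/-- The Leibniz rule for operators on the right: the sign arises when the differential of the left
factor passes over `y`. -/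
theorem diff_mul {X Y Z : Q.Obj} (x : TensorHom Q X Y) (y : TensorHom Q Y Z) :
    diff (mul x y) = mul x (diff y) + mul (diff x) (sign y) := by
  induction x using induction with
  | zero => simp
  | add x y hx hy => simp only [map_add, LinearMap.add_apply, hx, hy]; abel
  | unit a => simp [one_mul, diff_one]
  | cons a w x ih =>
    simp only [consL_mul, diff_consL, ih, map_add, LinearMap.add_apply, sign_mul, add_assoc]

theorem diff_sign {X Y : Q.Obj} (x : TensorHom Q X Y) : diff (sign x) = - sign (diff x) := by
  induction x using induction with
  | zero => simp
  | add x y hx hy => simp only [map_add, hx, hy]; abel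
  | unit a => simp [sign_one, diff_one]
  | cons a w x ih =>
    simp only [sign_consL, diff_consL, smul_units, ih, map_add, map_neg, Int.negOnePow_succ,
      smul_add, smul_neg, neg_add, Units.neg_smul, neg_neg]

/-- The two cross terms, with one differential on `a` and one on the tail, cancel by `diff_sign`. -/
theorem diff_diff {X Y : Q.Obj} (x : TensorHom Q X Y) : diff (diff x) = 0 := by
  induction x using induction with
  | zero => simp
  | add x y hx hy => simp only [map_add, hx, hy, add_zero]
  | unit a => simp [diff_one]
  | @cons X Z i a w x ih =>
    have h : ((Q.sHom X Z).d (i + 1) (i + 1 + 1)).hom (((Q.sHom X Z).d i (i + 1)).hom a) = 0 := by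
      rw [← ModuleCat.comp_apply, HomologicalComplex.d_comp_d]; rfl
    have h0 : ∀ {X Y Z : Q.Obj} {i : ℤ} (x : TensorHom Q Y Z),
        consL Z (0 : (Q.sHom X Y).X i) x = 0 := by
      intro X Y Z i x
      have : consL Z (0 : (Q.sHom X Y).X i) = (0 : TensorHom Q Y Z →ₗ[k] TensorHom Q X Z) := by
        refine hom_ext fun w x => ?_
        rw [consL_incl, Word.tmul_zero_left, LinearMap.zero_apply, LinearMap.zero_apply, map_zero]
      rw [this]; rfl
    simp only [diff_consL, map_add, ih, diff_sign, map_neg, h, h0, map_zero]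
    simp

end TensorHom

end TensorCategory

-- Edge contraction as deletion of a vertex

namespace PlaneTree

/-- Remove the vertex number `j` (counted from `0`, in the order where a vertex precedes the
vertices above it and left precedes right) from a forest, and attach the subtrees above it to the
vertex below it. -/
def removeVertex : List PlaneTree → ℕ → List PlaneTree
  | [], _ => []
  | leaf :: ts, j => leaf :: removeVertex ts j
  | node m :: ts, 0 => m ++ ts
  | node m :: ts, j + 1 =>
      if j < forestSize m then node (removeVertex m j) :: ts
      else node m :: removeVertex ts (j - forestSize m)

theorem removeVertex_append_right (l r : List PlaneTree) (j : ℕ) :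
    removeVertex (l ++ r) (forestSize l + j) = l ++ removeVertex r j := by
  induction l with
  | nil => simp [forestSize]
  | cons t l ih =>
    cases t with
    | leaf => simp [forestSize, size, removeVertex, ih]
    | node m =>
      have e : forestSize (node m :: l) + j = (forestSize m + (forestSize l + j)) + 1 := by
        simp only [forestSize, size]; omega
      rw [e, List.cons_append, removeVertex, if_neg (by omega), Nat.add_sub_cancel_left, ih,
        List.cons_append]

theorem removeVertex_append_left (l r : List PlaneTree) (j : ℕ) (h : j < forestSize l) :
    removeVertex (l ++ r) j = removeVertex l j ++ r := by
  induction l generalizing j with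
  | nil => simp [forestSize] at h
  | cons t l ih =>
    cases t with
    | leaf =>
      simp only [forestSize, size, Nat.zero_add] at h
      simp [removeVertex, ih j h]
    | node m =>
      cases j with
      | zero => simp [removeVertex]
      | succ j =>
        simp only [forestSize, size] at h
        simp only [List.cons_append, removeVertex]
        split_ifs with hj
        · rfl
        · rw [ih _ (by omega), List.cons_append]

theorem forestSize_removeVertex (l : List PlaneTree) (j : ℕ) (h : j < forestSize l) :
    forestSize (removeVertex l j) + 1 = forestSize l := by
  induction l, j using removeVertex.induct with
  | case1 => simp [forestSize] at h
  | case2 ts j ih =>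
    simp only [forestSize, size, Nat.zero_add] at h
    simp [removeVertex, forestSize, size, ih h]
  | case3 m ts => simp [removeVertex, forestSize, size, forestSize_append]; omega
  | case4 m ts j hj ih =>
    have := ih hj
    simp only [removeVertex, if_pos hj, forestSize, size]; omega
  | case5 m ts j hj ih =>
    simp only [forestSize, size] at h
    have := ih (by omega)
    simp only [removeVertex, if_neg hj, forestSize, size]; omega

/-- Deleting a vertex preserves the order of the others and lowers the number of each later one by
one, so vertex `j + 1` becomes vertex `j` once vertex `i ≤ j` is gone. -/
theorem removeVertex_comm (l : List PlaneTree) (i j : ℕ) (hij : i ≤ j)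
    (h : j + 1 < forestSize l) :
    removeVertex (removeVertex l (j + 1)) i = removeVertex (removeVertex l i) j := by
  induction l, i using removeVertex.induct generalizing j with
  | case1 => simp [forestSize] at h
  | case2 ts i ih =>
    simp only [forestSize, size, Nat.zero_add] at h
    simp [removeVertex, ih j hij h]
  | case3 m ts =>
    simp only [removeVertex]
    split_ifs with hj
    · rw [removeVertex, removeVertex_append_left _ _ _ hj]
    · obtain ⟨a, rfl⟩ := Nat.exists_eq_add_of_le (not_lt.1 hj)
      rw [removeVertex, removeVertex_append_right, Nat.add_sub_cancel_left]
  | case4 m ts i hi ih =>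
    obtain ⟨j, rfl⟩ : ∃ a, j = a + 1 := ⟨j - 1, by omega⟩
    simp only [removeVertex, if_pos hi]
    by_cases hj : j + 1 < forestSize m
    · have := forestSize_removeVertex m _ hi
      have := forestSize_removeVertex m _ hj
      rw [if_pos hj, removeVertex, if_pos (by omega), if_pos (by omega), ih j (by omega) hj]
    · have := forestSize_removeVertex m _ hi
      rw [if_neg hj, removeVertex, if_pos hi, if_neg (by omega)]
      congr 2; omega
  | case5 m ts i hi ih =>
    obtain ⟨j, rfl⟩ : ∃ a, j = a + 1 := ⟨j - 1, by omega⟩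
    simp only [forestSize, size] at h
    have e : j + 1 - forestSize m = (j - forestSize m) + 1 := by omega
    simp only [removeVertex, if_neg hi]
    rw [if_neg (by omega), if_neg (by omega), removeVertex, if_neg hi, e,
      ih _ (by omega) (by omega)]

theorem Reduced.two_le {ts : List PlaneTree} (h : Reduced (PlaneTree.node ts)) : 2 ≤ ts.length := by
  cases h; assumption

theorem Reduced.of_mem {ts : List PlaneTree} (h : Reduced (PlaneTree.node ts)) :
    ∀ t ∈ ts, Reduced t := by
  cases h; assumption

theorem reduced_node_iff {ts : List PlaneTree} :
    Reduced (node ts) ↔ 2 ≤ ts.length ∧ ∀ t ∈ ts, Reduced t :=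
  ⟨fun h => ⟨h.two_le, h.of_mem⟩, fun h => .node ts h.1 h.2⟩

/-- A deletion replaces one subtree by the at least two subtrees above it, so the number of edges at
the vertex below never drops. -/
theorem removeVertex_reduced (l : List PlaneTree) (j : ℕ) (h : ∀ t ∈ l, Reduced t) :
    (∀ t ∈ removeVertex l j, Reduced t) ∧ l.length ≤ (removeVertex l j).length := by
  induction l, j using removeVertex.induct with
  | case1 => simp [removeVertex]
  | case2 ts j ih =>
    have := ih fun t ht => h t (by simp [ht])
    simp only [removeVertex, List.forall_mem_cons, List.length_cons]
    exact ⟨⟨.leaf, this.1⟩, by omega⟩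
  | case3 m ts =>
    have hm := h (node m) (by simp)
    have := hm.two_le
    simp only [removeVertex, List.length_append, List.length_cons, List.mem_append]
    exact ⟨fun t ht => ht.elim (hm.of_mem t) fun ht => h t (by simp [ht]), by omega⟩
  | case4 m ts j hj ih =>
    have hm := h (node m) (by simp)
    have := ih hm.of_mem
    have := hm.two_le
    simp only [removeVertex, if_pos hj, List.forall_mem_cons, List.length_cons, reduced_node_iff]
    exact ⟨⟨⟨by omega, by tauto⟩, fun t ht => h t (by simp [ht])⟩, by omega⟩
  | case5 m ts j hj ih =>
    have := ih fun t ht => h t (by simp [ht])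
    simp only [removeVertex, if_neg hj, List.forall_mem_cons, List.length_cons]
    exact ⟨⟨h _ (by simp), this.1⟩, by omega⟩

/-- The prefix `l` is there for the induction: trees lying to the left of the deleted vertex are
moved into it one by one. -/
theorem contractsTo_node (l m : List PlaneTree) (j : ℕ) (h : j < forestSize m) :
    ContractsTo (node (l ++ m)) (forestSize l + j + 2) (node (l ++ removeVertex m j)) := by
  induction m, j using removeVertex.induct generalizing l with
  | case1 => simp [forestSize] at h
  | case2 ts j ih =>
    simp only [forestSize, size, Nat.zero_add] at h
    simpa [forestSize_append, forestSize, size, removeVertex] using ih (l ++ [leaf]) h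
  | case3 m ts =>
    have := ContractsTo.root l m ts
    rw [Nat.add_comm 1, List.append_assoc] at this
    rw [removeVertex]
    exact this
  | case4 m ts j hj ih =>
    have hm : ContractsTo (node m) (j + 2) (node (removeVertex m j)) := by
      simpa [forestSize] using ih [] hj
    have := ContractsTo.above l ts hm
    rw [removeVertex, if_pos hj]
    convert this using 1
    omega
  | case5 m ts j hj ih =>
    simp only [forestSize, size] at h
    have := ih (l ++ [node m]) (by omega)
    rw [removeVertex, if_neg hj]
    simp only [forestSize_append, forestSize, size, List.append_assoc, List.cons_append,
      List.nil_append] at this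
    convert this using 1
    omega

/-- An edge is determined by its highest vertex, which is any vertex but the root. The offset `2`
arises because `j` counts from `0` in the forest above the root, whereas heights count from `1` and
include the root. -/
theorem contractsTo_iff {t' t : PlaneTree} {h : ℕ} : ContractsTo t' h t ↔
    ∃ l j, t' = node l ∧ h = j + 2 ∧ j < forestSize l ∧ t = node (removeVertex l j) := by
  constructor
  · intro H
    induction H with
    | root l m r =>
      refine ⟨_, forestSize l, rfl, by omega, ?_, ?_⟩
      · simp only [forestSize_append, forestSize, size]; omega
      · have := removeVertex_append_right l (node m :: r) 0
        simp only [Nat.add_zero, removeVertex] at this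
        rw [this, List.append_assoc]
    | @above l r t' t h H ih =>
      obtain ⟨a, j, rfl, rfl, hj, rfl⟩ := ih
      refine ⟨_, forestSize l + (j + 1), rfl, by omega, ?_, ?_⟩
      · simp only [forestSize_append, forestSize, size]; omega
      · rw [removeVertex_append_right, removeVertex, if_pos hj]
  · rintro ⟨l, j, rfl, rfl, hj, rfl⟩
    simpa [forestSize] using contractsTo_node [] l j hj

theorem ContractsTo.two_le {t' t : PlaneTree} {h : ℕ} (H : ContractsTo t' h t) : 2 ≤ h := by
  obtain ⟨l, j, rfl, rfl, hj, rfl⟩ := contractsTo_iff.1 H; omega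

theorem ContractsTo.le_size {t' t : PlaneTree} {h : ℕ} (H : ContractsTo t' h t) :
    h ≤ t'.size := by
  obtain ⟨l, j, rfl, rfl, hj, rfl⟩ := contractsTo_iff.1 H
  simp only [size]; omega

theorem ContractsTo.unique {t' t s : PlaneTree} {h : ℕ} (H : ContractsTo t' h t)
    (H' : ContractsTo t' h s) : t = s := by
  obtain ⟨l, j, rfl, rfl, hj, rfl⟩ := contractsTo_iff.1 H
  obtain ⟨l', j', hl, hj', hj, rfl⟩ := contractsTo_iff.1 H'
  obtain rfl : l = l' := by injection hl
  obtain rfl : j = j' := by omega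
  rfl

theorem ContractsTo.reduced {t' t : PlaneTree} {h : ℕ} (H : ContractsTo t' h t)
    (h' : t'.Reduced) : t.Reduced := by
  obtain ⟨l, j, rfl, rfl, hj, rfl⟩ := contractsTo_iff.1 H
  have := removeVertex_reduced l j h'.of_mem
  exact .node _ (h'.two_le.trans this.2) this.1

theorem ContractsTo.swap_of_lt {t₂ t₁ t : PlaneTree} {i j : ℕ} (H₂ : ContractsTo t₂ j t₁)
    (H₁ : ContractsTo t₁ i t) (hij : i < j) :
    ∃ s, ContractsTo t₂ i s ∧ ContractsTo s (j - 1) t := by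
  obtain ⟨l, j, rfl, rfl, hj, rfl⟩ := contractsTo_iff.1 H₂
  obtain ⟨l', i, hl, rfl, hi, rfl⟩ := contractsTo_iff.1 H₁
  obtain rfl : removeVertex l j = l' := by injection hl
  obtain ⟨j, rfl⟩ : ∃ a, j = a + 1 := ⟨j - 1, by omega⟩
  have := forestSize_removeVertex l i (by omega)
  refine ⟨_, contractsTo_iff.2 ⟨l, i, rfl, rfl, by omega, rfl⟩,
    contractsTo_iff.2 ⟨_, j, rfl, by omega, by omega, ?_⟩⟩
  rw [removeVertex_comm l i j (by omega) hj]

theorem ContractsTo.swap_of_le {t₂ t₁ t : PlaneTree} {i j : ℕ} (H₂ : ContractsTo t₂ i t₁)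
    (H₁ : ContractsTo t₁ j t) (hij : i ≤ j) :
    ∃ s, ContractsTo t₂ (j + 1) s ∧ ContractsTo s i t := by
  obtain ⟨l, i, rfl, rfl, hi, rfl⟩ := contractsTo_iff.1 H₂
  obtain ⟨l', j, hl, rfl, hj, rfl⟩ := contractsTo_iff.1 H₁
  obtain rfl : removeVertex l i = l' := by injection hl
  have h1 := forestSize_removeVertex l i (by omega)
  have h2 := forestSize_removeVertex l (j + 1) (by omega)
  refine ⟨_, contractsTo_iff.2 ⟨l, j + 1, rfl, rfl, by omega, rfl⟩,
    contractsTo_iff.2 ⟨_, i, rfl, rfl, by omega, ?_⟩⟩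
  rw [removeVertex_comm l i j (by omega) (by omega)]

/-- The signed sum over all ways to insert two edges one after the other vanishes. -/
theorem sum_edgeInsertions_edgeInsertions {M : Type*} [AddCommGroup M] (t : PlaneTree)
    (f : PlaneTree → M) :
    ∑ e ∈ t.edgeInsertions, ∑ e' ∈ e.1.edgeInsertions,
      (((e.2 : ℤ) + e'.2).negOnePow • f e'.1) = 0 := by
  classical
  rw [Finset.sum_sigma']
  set S := t.edgeInsertions.sigma fun e => e.1.edgeInsertions with hS
  -- The summands with first height below the second are paired off with those where it is not.
  rw [← Finset.sum_filter_add_sum_filter_not S (fun x => x.1.2 < x.2.2), add_eq_zero_iff_eq_neg,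
    ← Finset.sum_neg_distrib]
  have hmem : ∀ x : (_ : PlaneTree × ℕ) × (PlaneTree × ℕ), x ∈ S ↔
      ContractsTo x.1.1 x.1.2 t ∧ x.2.1.Reduced ∧ ContractsTo x.2.1 x.2.2 x.1.1 := by
    rintro ⟨x, y⟩
    simp only [hS, Finset.mem_sigma, mem_edgeInsertions]
    exact ⟨fun h => ⟨h.1.2, h.2⟩, fun h => ⟨⟨h.2.2.reduced h.2.1, h.1⟩, h.2⟩⟩
  have hex : ∀ x (hx : x ∈ S.filter fun x => x.1.2 < x.2.2),
      ∃ s, ContractsTo x.2.1 x.1.2 s ∧ ContractsTo s (x.2.2 - 1) t := by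
    intro x hx
    rw [Finset.mem_filter, hmem] at hx
    exact hx.1.2.2.swap_of_lt hx.1.1 hx.2
  choose s hs₁ hs₂ using hex
  -- Heights `(i, j)` with `i < j` go to `(j - 1, i)`, the same two edges inserted in the other
  -- order. The sum of the heights changes by one, so the sign flips.
  refine Finset.sum_bij (fun x hx => ⟨(s x hx, x.2.2 - 1), (x.2.1, x.1.2)⟩) ?_ ?_ ?_ ?_
  · intro x hx
    have hx' := hx
    rw [Finset.mem_filter, hmem] at hx
    simp only [Finset.mem_filter, hmem]
    exact ⟨⟨hs₂ x hx', hx.1.2.1, hs₁ x hx'⟩, by omega⟩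
  · rintro ⟨⟨a₁, i₁⟩, ⟨b₁, j₁⟩⟩ hx ⟨⟨a₂, i₂⟩, ⟨b₂, j₂⟩⟩ hy hxy
    rw [Finset.mem_filter, hmem] at hx hy
    simp only [Sigma.mk.injEq, Prod.mk.injEq, heq_eq_eq] at hxy hx hy ⊢
    obtain ⟨⟨-, h⟩, rfl, rfl⟩ := hxy
    obtain rfl : j₁ = j₂ := by omega
    obtain rfl := hx.1.2.2.unique hy.1.2.2
    simp
  · rintro ⟨⟨a, j⟩, ⟨b, i⟩⟩ hy
    rw [Finset.mem_filter, hmem] at hy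
    simp only [not_lt] at hy
    obtain ⟨⟨h₁, hr, h₂⟩, hij⟩ := hy
    obtain ⟨a', h₃, h₄⟩ := h₂.swap_of_le h₁ hij
    have hx : (⟨(a', i), (b, j + 1)⟩ : (_ : PlaneTree × ℕ) × (PlaneTree × ℕ)) ∈
        S.filter fun x => x.1.2 < x.2.2 := by
      rw [Finset.mem_filter, hmem]
      exact ⟨⟨h₄, hr, h₃⟩, by simp only; omega⟩
    exact ⟨_, hx, by simp [(hs₁ _ hx).unique h₂]⟩
  · intro x hx
    rw [Finset.mem_filter] at hx
    rw [← Units.neg_smul]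
    congr 1
    have : ((x.2.2 - 1 : ℕ) : ℤ) = x.2.2 - 1 := by omega
    rw [this, ← Int.negOnePow_succ, Int.negOnePow_eq_iff]
    exact ⟨0, by ring⟩

/-- The position of a vertex in the order on a forest determines the tree that contains it; the
bounds say that `h₁` and `h₂` are heights of actual vertices of `a₁` and `a₂`. -/
theorem eq_of_height_eq {l₁ l₂ r₁ r₂ : List PlaneTree} {a₁ a₂ : PlaneTree} {h₁ h₂ : ℕ}
    (e : l₁ ++ a₁ :: r₁ = l₂ ++ a₂ :: r₂) (eh : forestSize l₁ + h₁ = forestSize l₂ + h₂)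
    (h₁_pos : 1 ≤ h₁) (h₂_pos : 1 ≤ h₂) (h₁_le : h₁ ≤ a₁.size) (h₂_le : h₂ ≤ a₂.size) :
    l₁ = l₂ ∧ a₁ = a₂ ∧ r₁ = r₂ ∧ h₁ = h₂ := by
  induction l₁ generalizing l₂ with
  | nil =>
    cases l₂ with
    | nil => simp_all [forestSize]
    | cons t l₂ =>
      simp only [List.nil_append, List.cons_append, List.cons.injEq] at e
      simp only [forestSize, ← e.1] at eh
      omega
  | cons t l₁ ih =>
    cases l₂ with
    | nil =>
      simp only [List.nil_append, List.cons_append, List.cons.injEq] at e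
      simp only [forestSize, e.1] at eh
      omega
    | cons t' l₂ =>
      simp only [List.cons_append, List.cons.injEq] at e
      obtain ⟨rfl, e⟩ := e
      simp only [forestSize] at eh
      simpa using ih e (by omega)

theorem take_cons_drop (ts : List PlaneTree) (r : ℕ) (h : r < ts.length) :
    ts = ts.take r ++ ts.getD r leaf :: ts.drop (r + 1) := by
  conv_lhs => rw [← List.take_append_drop r ts, List.drop_eq_getElem_cons h]
  rw [List.getD_eq_getElem _ _ h]

/-- An edge insertion into `node [t₁, …, tₘ]` either takes place in one of the `tⱼ`, or joins a
proper subsequence of at least two consecutive `tⱼ`. -/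
theorem sum_edgeInsertions_node {M : Type*} [AddCommGroup M] (ts : List PlaneTree)
    (h : Reduced (node ts)) (f : PlaneTree × ℕ → M) :
    ∑ e ∈ (node ts).edgeInsertions, f e =
      (∑ r ∈ Finset.range ts.length, ∑ e ∈ (ts.getD r leaf).edgeInsertions,
        f (node (ts.take r ++ e.1 :: ts.drop (r + 1)), 1 + forestSize (ts.take r) + e.2)) +
      ∑ x ∈ ((Finset.range ts.length).sigma fun r => Finset.Icc 2 (ts.length - r)).erase
          ⟨0, ts.length⟩,
        f (node (ts.take x.1 ++ node ((ts.drop x.1).take x.2) :: (ts.drop x.1).drop x.2),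
          1 + forestSize (ts.take x.1) + 1) := by
  classical
  rw [Finset.sum_sigma']
  set A := (Finset.range ts.length).sigma fun r => (ts.getD r leaf).edgeInsertions with hA
  -- The pair `⟨0, ts.length⟩` is excluded because joining all the trees would leave only one edge
  -- above the root.
  set B := ((Finset.range ts.length).sigma fun r => Finset.Icc 2 (ts.length - r)).erase
    ⟨0, ts.length⟩ with hB
  let a : (_ : ℕ) × (PlaneTree × ℕ) → PlaneTree × ℕ := fun x =>
    (node (ts.take x.1 ++ x.2.1 :: ts.drop (x.1 + 1)), 1 + forestSize (ts.take x.1) + x.2.2)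
  let b : (_ : ℕ) × ℕ → PlaneTree × ℕ := fun x =>
    (node (ts.take x.1 ++ node ((ts.drop x.1).take x.2) :: (ts.drop x.1).drop x.2),
      1 + forestSize (ts.take x.1) + 1)
  have hAmem : ∀ x ∈ A, x.1 < ts.length ∧ x.2.1.Reduced ∧
      ContractsTo x.2.1 x.2.2 (ts.getD x.1 leaf) := by
    intro x hx
    simpa only [hA, Finset.mem_sigma, Finset.mem_range, mem_edgeInsertions] using hx
  have hBmem : ∀ x, x ∈ B ↔ ¬ (x.1 = 0 ∧ x.2 = ts.length) ∧ x.1 < ts.length ∧ 2 ≤ x.2 ∧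
      x.2 ≤ ts.length - x.1 := by
    rintro ⟨x, y⟩
    simp [hB]
  have htake : ∀ {r r' : ℕ}, r < ts.length → r' < ts.length → ts.take r = ts.take r' →
      r = r' := by
    intro r r' hr hr' e
    have := congrArg List.length e
    simp only [List.length_take] at this
    omega
  have ha : Set.InjOn a A := by
    rintro ⟨r, e⟩ hx ⟨r', e'⟩ hy hxy
    obtain ⟨hr, -, he⟩ := hAmem _ hx
    obtain ⟨hr', -, he'⟩ := hAmem _ hy
    simp only [a, Prod.mk.injEq, node.injEq] at hxy hr hr' he he'
    obtain ⟨h1, h2, -, h3⟩ := eq_of_height_eq hxy.1 (by omega) (by have := he.two_le; omega)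
      (by have := he'.two_le; omega) he.le_size he'.le_size
    obtain rfl := htake hr hr' h1
    rw [Prod.ext h2 h3]
  have hb : Set.InjOn b B := by
    rintro ⟨r, n⟩ hx ⟨r', n'⟩ hy hxy
    obtain ⟨-, hr, hn⟩ := (hBmem _).1 hx
    obtain ⟨-, hr', hn'⟩ := (hBmem _).1 hy
    simp only [b, Prod.mk.injEq, node.injEq] at hxy hr hr' hn hn'
    obtain ⟨h1, h2, -, -⟩ := eq_of_height_eq hxy.1 (by omega) le_rfl le_rfl
      (by simp only [size]; omega) (by simp only [size]; omega)
    obtain rfl := htake hr hr' h1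
    have := congrArg List.length (node.inj h2)
    simp only [List.length_take, List.length_drop] at this
    obtain rfl : n = n' := by omega
    rfl
  -- A joining vertex has height `1` in its own subtree, whereas the highest vertex of an edge
  -- inside a subtree has height at least `2` there.
  have hab : Disjoint (A.image a) (B.image b) := by
    rw [Finset.disjoint_left]
    simp only [Finset.mem_image]
    rintro _ ⟨⟨r, e⟩, hx, rfl⟩ ⟨⟨r', n⟩, hy, hxy⟩
    obtain ⟨hr, -, he⟩ := hAmem _ hx
    have := he.two_le
    simp only [a, b, Prod.mk.injEq, node.injEq] at hxy hr he this
    obtain ⟨-, -, -, h3⟩ := eq_of_height_eq hxy.1 (by omega) le_rfl (by omega)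
      (by simp only [size]; omega) he.le_size
    omega
  have hins : (node ts).edgeInsertions = A.image a ∪ B.image b := by
    ext ⟨t', h'⟩
    simp only [Finset.mem_union, Finset.mem_image, mem_edgeInsertions]
    constructor
    · rintro ⟨hr, H⟩
      generalize hs : node ts = s at H
      cases H with
      | root l m r =>
        right
        obtain rfl := node.inj hs
        have hm := (hr.of_mem (node m) (by simp)).two_le
        have h2 := hr.two_le
        refine ⟨⟨l.length, m.length⟩, (hBmem _).2 ?_, ?_⟩
        · simp only [List.length_append, List.length_cons] at h2 ⊢
          omega
        · simp [b, List.append_assoc]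
      | @above l r t' t j H =>
        left
        obtain rfl := node.inj hs
        refine ⟨⟨l.length, (t', j)⟩, ?_, ?_⟩
        · simp only [hA, Finset.mem_sigma, Finset.mem_range, mem_edgeInsertions]
          refine ⟨by simp, hr.of_mem _ (by simp), ?_⟩
          simpa [List.getD_eq_getElem?_getD] using H
        · simp [a]
    · rintro (⟨⟨r, e⟩, hx, he⟩ | ⟨⟨r, n⟩, hx, he⟩)
      · obtain ⟨hr, hred, H⟩ := hAmem _ hx
        simp only [a, Prod.mk.injEq] at he hr hred H
        obtain ⟨rfl, rfl⟩ := he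
        have hts := take_cons_drop ts r hr
        have h2 := h.two_le
        constructor
        · refine reduced_node_iff.2 ⟨?_, ?_⟩
          · rw [hts] at h2
            simpa only [List.length_append, List.length_cons] using h2
          · intro t ht
            rcases List.mem_append.1 ht with ht | ht
            · exact h.of_mem t (List.mem_of_mem_take ht)
            · rcases List.mem_cons.1 ht with rfl | ht
              · exact hred
              · exact h.of_mem t (List.mem_of_mem_drop ht)
        · have := ContractsTo.above (ts.take r) (ts.drop (r + 1)) H
          rwa [← hts] at this
      · obtain ⟨hne, hr, hn⟩ := (hBmem _).1 hx
        simp only [b, Prod.mk.injEq] at he hne hr hn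
        obtain ⟨rfl, rfl⟩ := he
        constructor
        · refine reduced_node_iff.2 ⟨?_, ?_⟩
          · simp only [List.length_append, List.length_cons, List.length_take, List.length_drop]
            omega
          · intro t ht
            rcases List.mem_append.1 ht with ht | ht
            · exact h.of_mem t (List.mem_of_mem_take ht)
            · rcases List.mem_cons.1 ht with rfl | ht
              · refine reduced_node_iff.2 ⟨?_, fun t ht =>
                  h.of_mem t (List.mem_of_mem_drop (List.mem_of_mem_take ht))⟩
                simp only [List.length_take, List.length_drop]; omega
              · exact h.of_mem t (List.mem_of_mem_drop (List.mem_of_mem_drop ht))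
        · have := ContractsTo.root (ts.take r) ((ts.drop r).take n) ((ts.drop r).drop n)
          rwa [List.append_assoc, List.take_append_drop, List.take_append_drop] at this
  rw [hins, Finset.sum_union hab, Finset.sum_image ha, Finset.sum_image hb]

end PlaneTree

-- Functions additive in each entry of a sequence

namespace Chain

section Additive

variable {k : Type u} [CommRing k] {A : GradedQuiver.{u, v, w} k}

theorem append_assoc {X Y Z W : A.Obj} (c : Chain A X Y) (c' : Chain A Y Z) (c'' : Chain A Z W) :
    (c.append c').append c'' = c.append (c'.append c'') := by
  induction c with
  | nil => rfl
  | cons x c ih => simp only [append, ih]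

theorem length_drop {X Y : A.Obj} (c : Chain A X Y) (r : ℕ) :
    (c.drop r).length = c.length - r := by
  induction c generalizing r with
  | nil => simp [drop, length]
  | cons x c ih =>
    cases r with
    | zero => rfl
    | succ r =>
      rw [show (cons x c).length - (r + 1) = c.length - r by simp [length]]
      exact ih r

/-- A function on composable sequences that is additive in each entry. -/
def IsAdditive {M : Type*} [AddCommGroup M] {X Y : A.Obj} (f : Chain A X Y → M) : Prop :=
  ∀ ⦃Z W : A.Obj⦄ (l : Chain A X Z) (x x' : A.Hom Z W) (r : Chain A W Y),
    f (l.append (cons (x + x') r)) = f (l.append (cons x r)) + f (l.append (cons x' r))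

theorem isAdditive_sum {ι M : Type*} [AddCommGroup M] {X Y : A.Obj} (s : Finset ι)
    (f : ι → Chain A X Y → M) (h : ∀ i ∈ s, IsAdditive (f i)) :
    IsAdditive fun c => ∑ i ∈ s, f i c := by
  intro Z W l x x' r
  simp only [← Finset.sum_add_distrib]
  exact Finset.sum_congr rfl fun i hi => h i hi l x x' r

/-- A sum over all decompositions of a sequence into two parts is additive if each summand is
additive in both parts. -/
theorem isAdditive_sum_split {M : Type*} [AddCommGroup M] {X Y : A.Obj}
    (F : ℕ → ∀ Z : A.Obj, Chain A X Z → Chain A Z Y → M)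
    (hl : ∀ n Z (c : Chain A Z Y), IsAdditive fun l => F n Z l c)
    (hr : ∀ n Z (l : Chain A X Z), IsAdditive (F n Z l)) :
    IsAdditive fun c => ∑ r ∈ Finset.range (c.length + 1), F r _ (c.take r) (c.drop r) := by
  intro Z W l x x' r
  induction l with
  | nil X =>
    simp only [append, length, Finset.sum_range_succ' _ (r.length + 1)]
    simp only [take, drop, obj]
    rw [show F 0 X (nil X) (cons (x + x') r) = _ from hr 0 X (nil X) (nil X) x x' r, ← add_add_add_comm, ← Finset.sum_add_distrib]
    congr 1
    exact Finset.sum_congr rfl fun i _ => hl _ _ _ (nil X) x x' _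
  | @cons X X' Z y l ih =>
    simp only [append, length, Finset.sum_range_succ' _ (length _ + 1)]
    simp only [take, drop, obj]
    rw [show F 0 X (nil X) (cons y (l.append (cons (x + x') r))) = _ from
      hr 0 X (nil X) (cons y l) x x' r, ← add_add_add_comm]
    congr 1
    exact ih (fun n Z c => F (n + 1) Z (cons y c))
      (fun n Z c U V l z z' s => hl (n + 1) Z c (cons y l) z z' s)
      (fun n Z l => hr (n + 1) Z (cons y l)) x x'

end Additive

end Chain

-- The operations of `FQ` expressed through `TsQ`

section FreeOperations

variable {k : Type u} [CommRing k] {Q : DGQuiver.{u, v} k}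

open TensorHom (incl mul one diff sign lift)

theorem freeHom_ext {X Y : Q.Obj} {M : Type*} [AddCommGroup M] [Module k M]
    {f g : FreeHom Q X Y →ₗ[k] M} (h : ∀ p x, f (treeIncl p x) = g (treeIncl p x)) : f = g := by
  classical
  exact DirectSum.linearMap_ext k fun p => LinearMap.ext fun x => h p x

theorem b₁_treeIncl {X Y : Q.Obj} (p : TreeIndex Q X Y) (x : p.word.tensor) :
    b₁ (treeIncl p x) = b₁On p x := by
  classical
  exact DirectSum.toModule_lof (M := fun p : TreeIndex Q X Y => (p.word.tensor : Type u))
    (φ := b₁On) k p x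

theorem graft_forestIncl {X Y : Q.Obj} (q : ForestIndex Q X Y) (x : q.word.tensor)
    (h : 2 ≤ q.forest.length) : graft (forestIncl q x) = treeIncl (q.graft h) x := by
  classical
  refine (DirectSum.toModule_lof (M := fun q : ForestIndex Q X Y => (q.word.tensor : Type u))
    (φ := fun q => if h : 2 ≤ q.forest.length then treeIncl (q.graft h) else 0) k q x).trans ?_
  exact LinearMap.congr_fun (dif_pos h) x

theorem consForest_incl {X Y Z : Q.Obj} (p : TreeIndex Q X Y) (x : p.word.tensor)
    (q : ForestIndex Q Y Z) (y : q.word.tensor) :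
    consForest (treeIncl p x) (forestIncl q y) = ((p.tree.size : ℤ) * q.sDegree).negOnePow •
      forestIncl (ForestIndex.cons p q) (p.word.concat q.word (x ⊗ₜ[k] y)) := by
  classical
  simp only [consForest, treeIncl, forestIncl, DirectSum.toModule_lof, LinearMap.flip_apply]
  rfl

/-- The map `TsQ(X,Y) → sF_tQ(X,Y)`, the identity on tensors with as many factors as `t` has input
vertices and zero on all others. -/
noncomputable def treeOf {X Y : Q.Obj} (t : PlaneTree) : TensorHom Q X Y →ₗ[k] FreeHom Q X Y := by
  classical exact lift fun w =>
    if h : t.Reduced ∧ w.length = t.leaves then treeIncl ⟨t, w, h.1, h.2⟩ else 0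

theorem treeOf_incl {X Y : Q.Obj} (p : TreeIndex Q X Y) (x : p.word.tensor) :
    treeOf p.tree (incl p.word x) = treeIncl p x := by
  rw [treeOf, TensorHom.lift_incl, dif_pos ⟨p.reduced, p.length_eq⟩]

theorem treeOf_incl_of_ne {X Y : Q.Obj} {t : PlaneTree} {w : Word Q X Y} (x : w.tensor)
    (h : w.length ≠ t.leaves) : treeOf t (incl w x) = 0 := by
  rw [treeOf, TensorHom.lift_incl, dif_neg fun h' => h h'.2]
  rfl

theorem b₁On_apply {X Y : Q.Obj} (p : TreeIndex Q X Y) (x : p.word.tensor) :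
    b₁On p x = (p.tree.size : ℤ).negOnePow •
        ∑ j ∈ Finset.range p.word.length, treeIncl (p.bump j) (p.word.dAt j x) +
      ∑ e ∈ p.tree.edgeInsertions.attach,
        (1 + (e.1.2 : ℤ)).negOnePow • treeIncl (p.insert e.1 e.2) x := by
  rw [b₁On, LinearMap.add_apply, Finset.smul_sum]
  exact congrArg₂ _ (LinearMap.sum_apply _ _ _) (LinearMap.sum_apply _ _ _)

/-- No condition on the number of factors in `a` is needed: neither the differential nor an
insertion changes the number of factors or of inputs, so both sides vanish on words of the wrong
length. -/
theorem b₁_treeOf {X Y : Q.Obj} {t : PlaneTree} (ht : t.Reduced) (a : TensorHom Q X Y) :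
    b₁ (treeOf t a) = (t.size : ℤ).negOnePow • treeOf t (diff a) +
      ∑ e ∈ t.edgeInsertions, (1 + (e.2 : ℤ)).negOnePow • treeOf e.1 a := by
  have : b₁ ∘ₗ treeOf t = (t.size : ℤ).negOnePow • (treeOf t ∘ₗ diff) +
      ∑ e ∈ t.edgeInsertions, (1 + (e.2 : ℤ)).negOnePow •
        (treeOf e.1 : TensorHom Q X Y →ₗ[k] FreeHom Q X Y) := by
    refine TensorHom.hom_ext fun w x => ?_
    simp only [LinearMap.add_apply, LinearMap.sum_apply, LinearMap.smul_apply,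
      LinearMap.comp_apply, TensorHom.diff_incl, map_sum]
    by_cases h : w.length = t.leaves
    · obtain ⟨p, rfl, rfl⟩ : ∃ p : TreeIndex Q X Y, p.tree = t ∧ p.word = w :=
        ⟨⟨t, w, ht, h⟩, rfl, rfl⟩
      rw [treeOf_incl, b₁_treeIncl, b₁On_apply]
      congr 1
      · congr 1
        exact Finset.sum_congr rfl fun j _ => (treeOf_incl (p.bump j) _).symm
      · rw [← Finset.sum_attach p.tree.edgeInsertions]
        exact Finset.sum_congr rfl fun e _ =>
          congrArg _ (treeOf_incl (p.insert e.1 e.2) x).symm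
    · rw [treeOf_incl_of_ne x h, map_zero, Finset.sum_eq_zero, Finset.sum_eq_zero, smul_zero,
        add_zero]
      · intro e he
        rw [treeOf_incl_of_ne x, smul_zero]
        rwa [(PlaneTree.mem_edgeInsertions.1 he).2.leaves_eq]
      · intro j _
        exact treeOf_incl_of_ne _ (by rwa [Word.length_bump])
  simpa using LinearMap.congr_fun this a

theorem b₁_b₁ {X Y : Q.Obj} (x : FreeHom Q X Y) : b₁ (b₁ x) = 0 := by
  have : b₁ ∘ₗ b₁ = (0 : FreeHom Q X Y →ₗ[k] FreeHom Q X Y) := by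
    refine freeHom_ext fun p x => ?_
    rw [LinearMap.comp_apply, LinearMap.zero_apply, ← treeOf_incl, b₁_treeOf p.reduced, map_add,
      TensorHom.smul_units, b₁_treeOf p.reduced, TensorHom.diff_diff, map_zero, smul_zero,
      zero_add, map_sum]
    have h : ∀ e ∈ p.tree.edgeInsertions,
        b₁ ((1 + (e.2 : ℤ)).negOnePow • treeOf e.1 (incl p.word x)) =
          - ((p.tree.size : ℤ).negOnePow • ((1 + (e.2 : ℤ)).negOnePow •
            treeOf e.1 (diff (incl p.word x)))) +
          ∑ e' ∈ e.1.edgeInsertions,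
            ((e.2 : ℤ) + e'.2).negOnePow • treeOf e'.1 (incl p.word x) := by
      intro e he
      rw [PlaneTree.mem_edgeInsertions] at he
      rw [TensorHom.smul_units, b₁_treeOf he.1, smul_add, Finset.smul_sum, he.2.size_eq]
      congr 1
      -- The inserted tree has one vertex more than the original one, so the sign of its
      -- differential is opposite.
      · rw [smul_smul, smul_smul, ← Units.neg_smul, ← Int.negOnePow_add, ← Int.negOnePow_add,
          ← Int.negOnePow_succ]
        congr 2
        push_cast; ring
      · refine Finset.sum_congr rfl fun e' _ => ?_
        rw [smul_smul, ← Int.negOnePow_add]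
        congr 1
        rw [Int.negOnePow_eq_iff]
        exact ⟨1, by ring⟩
    rw [Finset.sum_congr rfl h, Finset.sum_add_distrib, Finset.sum_neg_distrib, Finset.smul_sum,
      add_neg_cancel_left]
    exact PlaneTree.sum_edgeInsertions_edgeInsertions p.tree fun t => treeOf t (incl p.word x)
  exact LinearMap.congr_fun this x

/-- Isolating one entry as the argument of a linear map gives additivity and homogeneity of `freeB`,
and allows signs and sums to be pulled out of an inner operation. -/
theorem exists_toForest_slot {X Y Z W : (freeQuiver Q).Obj} (l : Chain (freeQuiver Q) X Y)
    (r : Chain (freeQuiver Q) Z W) : ∃ φ : FreeHom Q Y Z →ₗ[k] ForestHom Q X W,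
      ∀ x : FreeHom Q Y Z, toForest (l.append (.cons x r)) = φ x := by
  induction l with
  | nil X => exact ⟨consForest.flip (toForest r), fun x => rfl⟩
  | cons y l ih =>
    obtain ⟨φ, h⟩ := ih
    refine ⟨consForest y ∘ₗ φ, fun x => ?_⟩
    rw [LinearMap.comp_apply, ← h]
    rfl

theorem exists_freeB_slot {X Y Z W : (freeQuiver Q).Obj} (l : Chain (freeQuiver Q) X Y)
    (r : Chain (freeQuiver Q) Z W) : ∃ φ : FreeHom Q Y Z →ₗ[k] FreeHom Q X W,
      ∀ x : FreeHom Q Y Z, freeB (l.append (.cons x r)) = φ x := by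
  obtain ⟨φ, h⟩ := exists_toForest_slot l r
  cases l with
  | nil =>
    cases r with
    | nil => exact ⟨b₁, fun x => rfl⟩
    | cons y r => exact ⟨graft ∘ₗ φ, fun x => congrArg graft (h x)⟩
  | cons y l =>
    cases l with
    | nil => exact ⟨graft ∘ₗ φ, fun x => congrArg graft (h x)⟩
    | cons z l => exact ⟨graft ∘ₗ φ, fun x => congrArg graft (h x)⟩

theorem isAdditive_freeB {X Y : (freeQuiver Q).Obj} :
    Chain.IsAdditive (M := FreeHom Q X Y) (freeB : Chain (freeQuiver Q) X Y → (freeQuiver Q).Hom X Y) := by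
  intro Z W l x x' r
  obtain ⟨φ, h⟩ := exists_freeB_slot l r
  exact (h _).trans ((map_add φ x x').trans (congrArg₂ _ (h x).symm (h x').symm))

-- Koszul signs and elementary sequences

/-- The sum of the degrees in `sQ`. -/
def wordDegree (L : List (PlaneTree × ℤ)) : ℤ := (L.map Prod.snd).sum

/-- The number of internal vertices. -/
def vertices (L : List (PlaneTree × ℤ)) : ℕ := PlaneTree.forestSize (L.map Prod.fst)

/-- The total degree in `sFQ`. -/
def totalDegree (L : List (PlaneTree × ℤ)) : ℤ := wordDegree L + vertices L

/-- The exponent of the sign in `(x₁ ⊗ ⋯ ⊗ xₙ)(s^{|t₁|} ⊗ ⋯ ⊗ s^{|tₙ|})`. -/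
def koszul : List (PlaneTree × ℤ) → ℤ
  | [] => 0
  | p :: L => p.1.size * totalDegree L + koszul L

theorem wordDegree_append (L L' : List (PlaneTree × ℤ)) :
    wordDegree (L ++ L') = wordDegree L + wordDegree L' := by
  simp [wordDegree]

theorem wordDegree_cons (p : PlaneTree × ℤ) (L : List (PlaneTree × ℤ)) :
    wordDegree (p :: L) = p.2 + wordDegree L := by
  simp [wordDegree]

theorem vertices_append (L L' : List (PlaneTree × ℤ)) :
    vertices (L ++ L') = vertices L + vertices L' := by
  simp [vertices, PlaneTree.forestSize_append]

theorem vertices_cons (p : PlaneTree × ℤ) (L : List (PlaneTree × ℤ)) :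
    vertices (p :: L) = p.1.size + vertices L := by
  simp [vertices, PlaneTree.forestSize]

theorem totalDegree_append (L L' : List (PlaneTree × ℤ)) :
    totalDegree (L ++ L') = totalDegree L + totalDegree L' := by
  simp only [totalDegree, wordDegree_append, vertices_append]; push_cast; ring

/-- The extra term comes from moving the `vertices L` shifts of the left block past the elements of
the right block. -/
theorem koszul_append (L L' : List (PlaneTree × ℤ)) :
    koszul (L ++ L') = koszul L + koszul L' + vertices L * totalDegree L' := by
  induction L with
  | nil => simp [koszul, vertices, PlaneTree.forestSize]
  | cons p L ih =>
    simp only [List.cons_append, koszul, ih, totalDegree_append, vertices_cons]; push_cast; ring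

theorem totalDegree_eq_sum (L : List (PlaneTree × ℤ)) :
    totalDegree L = (L.map fun p => p.2 + (p.1.size : ℤ)).sum := by
  induction L with
  | nil => simp [totalDegree, wordDegree, vertices, PlaneTree.forestSize]
  | cons p L ih =>
    rw [List.map_cons, List.sum_cons, ← ih, totalDegree, totalDegree, wordDegree_cons,
      vertices_cons]
    push_cast; ring

theorem Word.degree_append {X Y Z : Q.Obj} (w : Word Q X Y) (w' : Word Q Y Z) :
    (w.append w').degree = w.degree + w'.degree := by
  induction w with
  | nil => simp [append, degree]
  | cons i w ih => simp only [append, degree, ih, add_assoc]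

theorem Word.degree_bump {X Y : Q.Obj} (w : Word Q X Y) (j : ℕ) (h : j < w.length) :
    (w.bump j).degree = w.degree + 1 := by
  induction w generalizing j with
  | nil => simp [length] at h
  | cons i w ih =>
    cases j with
    | zero => simp only [bump, degree]; ring
    | succ j =>
      simp only [length] at h
      simp only [bump, degree, ih j (by omega)]; ring

/-- `IsElementary c L a` says that the entries of `c` lie in summands of `sFQ`, that `L` lists the
trees and the degrees in `TsQ` of these entries, and that `a` is the product of the entries in
`TsQ`. -/
inductive IsElementary : {X Y : Q.Obj} → Chain (freeQuiver Q) X Y → List (PlaneTree × ℤ) →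
    TensorHom Q X Y → Prop
  | nil (X : Q.Obj) : IsElementary (.nil X) [] (one X)
  | cons {X Y Z : Q.Obj} (p : TreeIndex Q X Y) (x : p.word.tensor)
      {c : Chain (freeQuiver Q) Y Z} {L : List (PlaneTree × ℤ)} {a : TensorHom Q Y Z}
      (h : IsElementary c L a) :
      IsElementary (.cons (show FreeHom Q X Y from treeIncl p x) c)
        ((p.tree, p.word.degree) :: L) (mul (incl p.word x) a)

namespace IsElementary

theorem length_eq {X Y : Q.Obj} {c : Chain (freeQuiver Q) X Y} {L : List (PlaneTree × ℤ)}
    {a : TensorHom Q X Y} (h : IsElementary c L a) : c.length = L.length := by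
  induction h with
  | nil => rfl
  | cons p x h ih => simp [Chain.length, ih]

theorem reduced {X Y : Q.Obj} {c : Chain (freeQuiver Q) X Y} {L : List (PlaneTree × ℤ)}
    {a : TensorHom Q X Y} (h : IsElementary c L a) : ∀ t ∈ L.map Prod.fst, t.Reduced := by
  induction h with
  | nil => simp
  | cons p x h ih =>
    rw [List.map_cons, List.forall_mem_cons]
    exact ⟨p.reduced, ih⟩

theorem sign_eq {X Y : Q.Obj} {c : Chain (freeQuiver Q) X Y} {L : List (PlaneTree × ℤ)}
    {a : TensorHom Q X Y} (h : IsElementary c L a) :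
    sign a = (wordDegree L).negOnePow • a := by
  induction h with
  | nil => simp [TensorHom.sign_one, wordDegree]
  | cons p x h ih =>
    rw [TensorHom.sign_mul, ih, TensorHom.sign_incl, TensorHom.smul_units, wordDegree_cons,
      Units.smul_def p.word.degree.negOnePow, map_zsmul, LinearMap.smul_apply, ← Units.smul_def,
      smul_smul, Int.negOnePow_add, _root_.mul_comm]

theorem append {X Y Z : Q.Obj} {c : Chain (freeQuiver Q) X Y} {L : List (PlaneTree × ℤ)}
    {a : TensorHom Q X Y} (h : IsElementary c L a) {c' : Chain (freeQuiver Q) Y Z}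
    {L' : List (PlaneTree × ℤ)} {a' : TensorHom Q Y Z} (h' : IsElementary c' L' a') :
    IsElementary (c.append c') (L ++ L') (mul a a') := by
  induction h with
  | nil => rwa [TensorHom.one_mul]
  | cons p x h ih => rw [TensorHom.mul_assoc]; exact .cons p x (ih h')

theorem split {X Y : Q.Obj} {c : Chain (freeQuiver Q) X Y} {L : List (PlaneTree × ℤ)}
    {a : TensorHom Q X Y} (h : IsElementary c L a) (r : ℕ) :
    ∃ (a₁ : TensorHom Q X (c.obj r)) (a₂ : TensorHom Q (c.obj r) Y),
      IsElementary (c.take r) (L.take r) a₁ ∧ IsElementary (c.drop r) (L.drop r) a₂ ∧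
        mul a₁ a₂ = a := by
  induction h generalizing r with
  | nil X =>
    refine ⟨one X, one X, ?_, ?_, TensorHom.one_mul _⟩
    · rw [List.take_nil]; exact .nil X
    · rw [List.drop_nil]; exact .nil X
  | cons p x h ih =>
    cases r with
    | zero => exact ⟨one _, _, .nil _, .cons p x h, TensorHom.one_mul _⟩
    | succ r =>
      obtain ⟨a₁, a₂, h₁, h₂, rfl⟩ := ih r
      exact ⟨_, a₂, .cons p x h₁, h₂, TensorHom.mul_assoc _ _ _⟩

/-- The index `q` is given by a witness, since its word depends on the entries of `c`; only its
forest, its degree and the product in `TsQ` matter later. -/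
theorem toForest_eq {X Y : Q.Obj} {c : Chain (freeQuiver Q) X Y} {L : List (PlaneTree × ℤ)}
    {a : TensorHom Q X Y} (h : IsElementary c L a) :
    ∃ (q : ForestIndex Q X Y) (y : q.word.tensor), q.forest = L.map Prod.fst ∧
      q.word.degree = wordDegree L ∧ incl q.word y = a ∧
      toForest c = (koszul L).negOnePow • forestIncl q y := by
  induction h with
  | nil X =>
    exact ⟨.nil X, Word.unit X, rfl, rfl, rfl, by simp [koszul]; rfl⟩
  | cons p x h ih =>
    obtain ⟨q, y, h₁, h₂, rfl, h₃⟩ := ih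
    refine ⟨.cons p q, p.word.concat q.word (x ⊗ₜ[k] y), ?_, ?_, ?_, ?_⟩
    · simp [ForestIndex.cons, h₁]
    · simp only [ForestIndex.cons, Word.degree_append, h₂, wordDegree_cons]
    · rw [TensorHom.mul_incl]; rfl
    · refine (congrArg (consForest (treeIncl p x)) h₃).trans ?_
      rw [TensorHom.smul_units, consForest_incl, smul_smul, ← Int.negOnePow_add,
        ForestIndex.sDegree, h₂, h₁, koszul, add_comm]
      rfl

theorem freeB_eq {X Y : Q.Obj} {c : Chain (freeQuiver Q) X Y} {L : List (PlaneTree × ℤ)}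
    {a : TensorHom Q X Y} (h : IsElementary c L a) (hL : 2 ≤ L.length) :
    ∃ (p : TreeIndex Q X Y) (y : p.word.tensor), p.tree = .node (L.map Prod.fst) ∧
      p.word.degree = wordDegree L ∧ incl p.word y = a ∧
      freeB c = (koszul L).negOnePow • treeIncl p y := by
  obtain ⟨q, y, h₁, h₂, h₃, h₄⟩ := h.toForest_eq
  have hq : 2 ≤ q.forest.length := by rwa [h₁, List.length_map]
  refine ⟨q.graft hq, y, congrArg _ h₁, h₂, h₃, ?_⟩
  rw [← graft_forestIncl q y hq, ← TensorHom.smul_units, ← h₄]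
  rw [← h.length_eq] at hL
  match c, hL with
  | .cons _ (.cons _ _), _ => rfl

theorem freeB_eq_treeOf {X Y : Q.Obj} {c : Chain (freeQuiver Q) X Y} {L : List (PlaneTree × ℤ)}
    {a : TensorHom Q X Y} (h : IsElementary c L a) (hL : 2 ≤ L.length) :
    freeB c = (koszul L).negOnePow • (treeOf (.node (L.map Prod.fst)) a : FreeHom Q X Y) := by
  obtain ⟨p, y, h₁, -, rfl, h₂⟩ := h.freeB_eq hL
  rw [h₂, ← treeOf_incl, h₁]

theorem freeB_singleton {X Y : Q.Obj} {c : Chain (freeQuiver Q) X Y} {L : List (PlaneTree × ℤ)}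
    {a : TensorHom Q X Y} (h : IsElementary c L a) (hL : L.length = 1) :
    ∃ (p : TreeIndex Q X Y) (y : p.word.tensor), L = [(p.tree, p.word.degree)] ∧
      incl p.word y = a ∧ freeB c = b₁ (treeIncl p y) := by
  cases h with
  | nil => simp at hL
  | cons p x h =>
    cases h with
    | nil => exact ⟨p, x, rfl, (TensorHom.mul_one _).symm, rfl⟩
    | cons => simp at hL

end IsElementary

end FreeOperations

-- Reduction to elementary sequences, and the degree of the operations

section FreeCategory

variable {k : Type u} [CommRing k] {Q : DGQuiver.{u, v} k}

open TensorHom (incl mul one diff sign lift)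

theorem Chain.append_nil {A : GradedQuiver.{u, v, w} k} {X Y : A.Obj} (c : Chain A X Y) :
    c.append (.nil Y) = c := by
  induction c with
  | nil => rfl
  | cons x c ih => rw [append, ih]

/-- The value of a function that is additive in each entry, as a function of one entry. -/
noncomputable def Chain.IsAdditive.slot {X Y Z W : (freeQuiver Q).Obj} {M : Type*} [AddCommGroup M]
    {f : Chain (freeQuiver Q) X Y → M} (hf : Chain.IsAdditive f) (l : Chain (freeQuiver Q) X Z)
    (r : Chain (freeQuiver Q) W Y) : FreeHom Q Z W →+ M :=
  AddMonoidHom.mk' (fun x => f (l.append (.cons x r))) fun x x' => hf l x x' r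

theorem mem_of_isElementary_aux {X Y Z : (freeQuiver Q).Obj} {M : Type*} [AddCommGroup M]
    (N : AddSubgroup M) {f : Chain (freeQuiver Q) X Y → M} (hf : Chain.IsAdditive f) (is : List ℤ)
    (H : ∀ c L a, IsElementary c L a → L.map (fun p => p.2 + (p.1.size : ℤ)) = is → f c ∈ N)
    (c : Chain (freeQuiver Q) Z Y) (js : List ℤ) (hc : c.HasSDegrees js)
    (l : Chain (freeQuiver Q) X Z) (L : List (PlaneTree × ℤ)) (a : TensorHom Q X Z)
    (hl : IsElementary l L a) (hjs : L.map (fun p => p.2 + (p.1.size : ℤ)) ++ js = is) :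
    f (l.append c) ∈ N := by
  classical
  induction c generalizing js L with
  | nil Y =>
    cases js with
    | cons => exact hc.elim
    | nil => rw [Chain.append_nil]; exact H l L a hl (by simpa using hjs)
  | @cons Z W Y x c ih =>
    cases js with
    | nil => exact hc.elim
    | cons i js =>
      obtain ⟨hx, hc⟩ := hc
      change FreeHom Q Z W at x
      change hf.slot l c x ∈ N
      rw [← DirectSum.sum_support_of x, map_sum]
      refine AddSubgroup.sum_mem _ fun p hp => ?_
      -- Homogeneity of the entry leaves only components of degree `i`, so the list of degrees, and
      -- with it every sign, is the same for all elementary sequences that arise.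
      have hpi : p.sDegree = i := by
        by_contra hne
        rw [DFinsupp.mem_support_iff] at hp
        exact hp (hx p fun h => hne (by omega))
      change f (l.append (.cons (treeIncl p (x p)) c)) ∈ N
      have := ih hf H js hc (l.append (.cons (show FreeHom Q Z W from treeIncl p (x p)) (.nil W)))
        (L ++ [(p.tree, p.word.degree)]) _ (hl.append (.cons p (x p) (.nil W)))
        (by rw [← hjs, ← hpi]; simp [TreeIndex.sDegree])
      rwa [Chain.append_assoc] at this

/-- A property of the values of a function that is additive in each entry can be checked on
elementary sequences. -/
theorem mem_of_isElementary {X Y : (freeQuiver Q).Obj} {M : Type*} [AddCommGroup M]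
    (N : AddSubgroup M) {f : Chain (freeQuiver Q) X Y → M} (hf : Chain.IsAdditive f) (is : List ℤ)
    (H : ∀ c L a, IsElementary c L a → L.map (fun p => p.2 + (p.1.size : ℤ)) = is → f c ∈ N)
    (c : Chain (freeQuiver Q) X Y) (hc : c.HasSDegrees is) : f c ∈ N :=
  mem_of_isElementary_aux N hf is H c is hc (.nil X) [] (one X) (.nil X) rfl

theorem treeIncl_mem_freeDeg {X Y : Q.Obj} (p : TreeIndex Q X Y) (x : p.word.tensor) :
    treeIncl p x ∈ freeDeg Q X Y (p.sDegree + 1) := by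
  classical
  intro q hq
  refine DirectSum.of_eq_of_ne _ _ _ ?_
  rintro rfl
  omega

theorem smul_units_mem {M : Type*} [AddCommGroup M] [Module k M] (N : Submodule k M) (s : ℤˣ)
    {x : M} (hx : x ∈ N) : s • x ∈ N := by
  rw [Units.smul_def]
  exact N.toAddSubgroup.zsmul_mem hx _

theorem b₁On_mem_freeDeg {X Y : Q.Obj} (p : TreeIndex Q X Y) (x : p.word.tensor) :
    b₁On p x ∈ freeDeg Q X Y (p.sDegree + 1 + 1) := by
  rw [b₁On_apply]
  refine Submodule.add_mem _ (smul_units_mem _ _ (Submodule.sum_mem _ fun j hj => ?_))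
    (Submodule.sum_mem _ fun e _ => smul_units_mem _ _ ?_)
  · have := treeIncl_mem_freeDeg (p.bump j) (p.word.dAt j x)
    have e : (p.bump j).sDegree = p.sDegree + 1 := by
      simp only [TreeIndex.sDegree, TreeIndex.bump,
        Word.degree_bump _ _ (Finset.mem_range.1 hj)]
      ring
    rwa [e] at this
  · have := treeIncl_mem_freeDeg (p.insert e.1 e.2) x
    have h := (PlaneTree.mem_edgeInsertions.1 e.2).2.size_eq
    have e : (p.insert e.1 e.2).sDegree = p.sDegree + 1 := by
      simp only [TreeIndex.sDegree, TreeIndex.insert, h]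
      push_cast; ring
    rwa [e] at this

/-- One `+ 1` is the degree of the operation, the other translates degrees in `sFQ` into degrees in
`FQ`. For `n ≥ 2` the degree rises because grafting creates one new vertex. -/
theorem IsElementary.freeB_mem {X Y : Q.Obj} {c : Chain (freeQuiver Q) X Y}
    {L : List (PlaneTree × ℤ)} {a : TensorHom Q X Y} (h : IsElementary c L a) :
    freeB c ∈ freeDeg Q X Y (totalDegree L + 1 + 1) := by
  rcases Nat.lt_or_ge 1 L.length with h2 | h2
  · obtain ⟨p, y, h₁, h₂, -, h₃⟩ := h.freeB_eq h2
    have e : p.sDegree = totalDegree L + 1 := by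
      unfold TreeIndex.sDegree
      rw [h₁, h₂, PlaneTree.size, totalDegree, vertices]
      push_cast; ring
    rw [h₃, ← e]
    exact smul_units_mem _ _ (treeIncl_mem_freeDeg p y)
  · rcases Nat.eq_zero_or_pos L.length with h0 | h1
    · cases h with
      | nil => exact (freeDeg Q _ _ _).zero_mem
      | cons => simp at h0
    · obtain ⟨p, y, rfl, -, h₁⟩ := h.freeB_singleton (by omega)
      have e : totalDegree [(p.tree, p.word.degree)] = p.sDegree := by
        simp [totalDegree, wordDegree, vertices, TreeIndex.sDegree, PlaneTree.forestSize]
      rw [h₁, b₁_treeIncl, e]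
      exact b₁On_mem_freeDeg p y

theorem freeB_mem {X Y : (freeQuiver Q).Obj} (c : Chain (freeQuiver Q) X Y) (is : List ℤ)
    (hc : c.HasSDegrees is) : freeB c ∈ (freeQuiver Q).sDeg X Y (is.sum + 1) := by
  refine mem_of_isElementary (M := FreeHom Q X Y) (freeDeg Q X Y (is.sum + 1 + 1)).toAddSubgroup
    isAdditive_freeB is ?_ c hc
  intro c L a h hL
  rw [← hL, ← totalDegree_eq_sum]
  exact h.freeB_mem

theorem units_smul_sum {ι M : Type*} [AddCommGroup M] (s : ℤˣ) (t : Finset ι) (f : ι → M) :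
    s • ∑ i ∈ t, f i = ∑ i ∈ t, s • f i :=
  Finset.smul_sum

theorem negOnePow_smul_smul {M : Type*} [AddCommGroup M] (a b : ℤ) (x : M) :
    a.negOnePow • b.negOnePow • x = (a + b).negOnePow • x := by
  rw [smul_smul, Int.negOnePow_add]

theorem negOnePow_smul_eq {M : Type*} [AddCommGroup M] {a b : ℤ} (x : M) (c : ℤ)
    (h : a - b = c + c) : a.negOnePow • x = b.negOnePow • x := by
  rw [(Int.negOnePow_eq_iff a b).2 ⟨c, h⟩]

theorem size_node (L : List (PlaneTree × ℤ)) :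
    (PlaneTree.node (L.map Prod.fst)).size = 1 + vertices L := by
  rw [PlaneTree.size, vertices]

theorem totalDegree_cons (p : PlaneTree × ℤ) (L : List (PlaneTree × ℤ)) :
    totalDegree (p :: L) = p.2 + p.1.size + totalDegree L := by
  rw [totalDegree, totalDegree, wordDegree_cons, vertices_cons]
  push_cast; ring

-- The terms of the equation on elementary sequences

namespace IsElementary

variable {X Y Z W : Q.Obj} {l : Chain (freeQuiver Q) X Y} {m : Chain (freeQuiver Q) Y Z}
  {r : Chain (freeQuiver Q) Z W} {L₁ L₂ L₃ : List (PlaneTree × ℤ)} {a₁ : TensorHom Q X Y}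
  {a₂ : TensorHom Q Y Z} {a₃ : TensorHom Q Z W}

theorem freeB_insert (h₁ : IsElementary l L₁ a₁) (h₃ : IsElementary r L₃ a₃)
    (hL : 1 ≤ L₁.length + L₃.length) (p : TreeIndex Q Y Z) (x : p.word.tensor) :
    freeB (l.append (.cons (show FreeHom Q Y Z from treeIncl p x) r)) =
      (koszul (L₁ ++ (p.tree, p.word.degree) :: L₃)).negOnePow •
        (treeOf (.node (L₁.map Prod.fst ++ p.tree :: L₃.map Prod.fst))
          (mul a₁ (mul (incl p.word x) a₃)) : FreeHom Q X W) := by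
  have := (h₁.append (.cons p x h₃)).freeB_eq_treeOf
    (by simp only [List.length_append, List.length_cons]; omega)
  rwa [List.map_append, List.map_cons] at this

/-- The term of the `A∞`-equation in which the inner operation is `bₙ`, `n ≥ 2`, and the outer one
is not `b₁`. -/
theorem freeB_freeB_join (h₁ : IsElementary l L₁ a₁) (h₂ : IsElementary m L₂ a₂)
    (h₃ : IsElementary r L₃ a₃) (hL : 1 ≤ L₁.length + L₃.length) (hL₂ : 2 ≤ L₂.length) :
    (totalDegree L₃).negOnePow •
        (show FreeHom Q X W from freeB (l.append (.cons (freeB m) r))) =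
      (koszul (L₁ ++ (L₂ ++ L₃))).negOnePow • ((vertices L₁ : ℤ).negOnePow •
        (treeOf (.node (L₁.map Prod.fst ++ .node (L₂.map Prod.fst) :: L₃.map Prod.fst))
          (mul a₁ (mul a₂ a₃)) : FreeHom Q X W)) := by
  obtain ⟨p, x, hp, hd, rfl, e⟩ := h₂.freeB_eq hL₂
  obtain ⟨φ, hφ⟩ := exists_freeB_slot l r
  have h := h₁.freeB_insert h₃ hL p x
  rw [hφ] at h
  rw [show freeB (l.append (.cons (freeB m) r)) = φ (freeB m) from hφ _, e]
  change (totalDegree L₃).negOnePow • φ ((koszul L₂).negOnePow • treeIncl p x) = _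
  rw [TensorHom.smul_units]
  change _ • _ • φ (show FreeHom Q Y Z from treeIncl p x) = _
  rw [h, hp, hd, negOnePow_smul_smul, negOnePow_smul_smul, negOnePow_smul_smul]
  -- The shift of the new vertex passes `L₃` and contributes a second `totalDegree L₃`, which
  -- cancels the sign of `1 ⊗ bₙ ⊗ 1`. The shifts of `L₁` pass an element whose degree has grown by
  -- one, which leaves `vertices L₁`.
  refine negOnePow_smul_eq _ (totalDegree L₃ + vertices L₂ * 0) ?_
  simp only [koszul_append, koszul, totalDegree_append, totalDegree_cons, size_node]
  simp only [totalDegree]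
  push_cast
  ring

/-- The term of the `A∞`-equation in which the inner operation is `b₁` and the outer one is not. -/
theorem freeB_freeB_inner (h₁ : IsElementary l L₁ a₁) (h₂ : IsElementary m L₂ a₂)
    (h₃ : IsElementary r L₃ a₃) (hL : 1 ≤ L₁.length + L₃.length) {t : PlaneTree} {d : ℤ}
    (hL₂ : L₂ = [(t, d)]) :
    (totalDegree L₃).negOnePow •
        (show FreeHom Q X W from freeB (l.append (.cons (freeB m) r))) =
      (koszul (L₁ ++ (L₂ ++ L₃))).negOnePow •
        ((vertices (L₁ ++ (L₂ ++ L₃)) + wordDegree L₃ : ℤ).negOnePow •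
          (treeOf (.node ((L₁ ++ (L₂ ++ L₃)).map Prod.fst))
            (mul a₁ (mul (diff a₂) a₃)) : FreeHom Q X W) +
        ∑ e ∈ t.edgeInsertions, (1 + vertices L₁ + e.2 : ℤ).negOnePow •
          (treeOf (.node (L₁.map Prod.fst ++ e.1 :: L₃.map Prod.fst))
            (mul a₁ (mul a₂ a₃)) : FreeHom Q X W)) := by
  obtain ⟨p, x, hp, rfl, e⟩ := h₂.freeB_singleton (by simp [hL₂])
  obtain ⟨rfl, rfl⟩ : p.tree = t ∧ p.word.degree = d := by
    simpa only [hL₂, List.cons.injEq, Prod.mk.injEq, and_true, eq_comm] using hp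
  obtain ⟨φ, hφ⟩ := exists_freeB_slot l r
  have h : ∀ (q : TreeIndex Q Y Z) (y : q.word.tensor), φ (treeIncl q y) =
      (koszul (L₁ ++ (q.tree, q.word.degree) :: L₃)).negOnePow •
        (treeOf (.node (L₁.map Prod.fst ++ q.tree :: L₃.map Prod.fst))
          (mul a₁ (mul (incl q.word y) a₃)) : FreeHom Q X W) := fun q y =>
    (hφ _).symm.trans (h₁.freeB_insert h₃ hL q y)
  rw [show freeB (l.append (.cons (freeB m) r)) = φ (freeB m) from hφ _, e]
  change (totalDegree L₃).negOnePow • φ (b₁ (treeIncl p x)) = _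
  subst hL₂
  rw [b₁_treeIncl, b₁On_apply, map_add, TensorHom.smul_units, map_sum, map_sum, smul_add,
    smul_add, TensorHom.diff_incl]
  congr 1
  · simp only [map_sum, LinearMap.sum_apply, units_smul_sum]
    refine Finset.sum_congr rfl fun j hj => ?_
    have hb : φ (treeIncl (p.bump j) (p.word.dAt j x)) =
        (koszul (L₁ ++ (p.tree, p.word.degree + 1) :: L₃)).negOnePow •
          (treeOf (.node (L₁.map Prod.fst ++ p.tree :: L₃.map Prod.fst))
            (mul a₁ (mul (incl (p.word.bump j) (p.word.dAt j x)) a₃)) : FreeHom Q X W) := by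
      rw [← Word.degree_bump _ _ (Finset.mem_range.1 hj)]
      exact h (p.bump j) _
    refine (congrArg (fun z => (totalDegree L₃).negOnePow •
      (p.tree.size : ℤ).negOnePow • z) hb).trans ?_
    simp only [negOnePow_smul_smul, List.map_append, List.map_cons, List.singleton_append]
    -- Raising the middle degree adds `vertices L₁` to the Koszul exponent; with `|t|` from `b₁` and
    -- `totalDegree L₃` from the outer sign this is the number of all vertices plus `wordDegree L₃`.
    refine negOnePow_smul_eq _ 0 ?_
    simp only [koszul_append, koszul, totalDegree_cons, vertices_append, vertices_cons]
    simp only [totalDegree]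
    push_cast
    ring
  · rw [← Finset.sum_attach p.tree.edgeInsertions]
    simp only [units_smul_sum]
    refine Finset.sum_congr rfl fun e _ => ?_
    rw [TensorHom.smul_units]
    have he := (PlaneTree.mem_edgeInsertions.1 e.2).2.size_eq
    refine (congrArg (fun z => (totalDegree L₃).negOnePow •
      (1 + e.1.2 : ℤ).negOnePow • z) (h (p.insert e.1 e.2) x)).trans ?_
    simp only [TreeIndex.insert, negOnePow_smul_smul, List.singleton_append]
    -- The vertex added to the middle tree changes the Koszul exponent by `vertices L₁ + totalDegree
    -- L₃`, and the second summand cancels the outer sign.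
    refine negOnePow_smul_eq _ (totalDegree L₃) ?_
    simp only [koszul_append, koszul, totalDegree_cons, he]
    push_cast
    ring

/-- The term of the `A∞`-equation in which the outer operation is `b₁`. -/
theorem freeB_freeB_outer (h₁ : IsElementary l [] a₁) (h₂ : IsElementary m L₂ a₂)
    (h₃ : IsElementary r [] a₃) (hL₂ : 2 ≤ L₂.length) :
    (show FreeHom Q X W from freeB (l.append (.cons (freeB m) r))) =
      (koszul L₂).negOnePow • ((1 + vertices L₂ : ℤ).negOnePow •
          (treeOf (.node (L₂.map Prod.fst)) (diff (mul a₁ (mul a₂ a₃))) : FreeHom Q X W) +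
        ∑ e ∈ (PlaneTree.node (L₂.map Prod.fst)).edgeInsertions, (1 + e.2 : ℤ).negOnePow •
          (treeOf e.1 (mul a₁ (mul a₂ a₃)) : FreeHom Q X W)) := by
  cases h₁
  cases h₃
  rw [TensorHom.one_mul, TensorHom.mul_one]
  obtain ⟨p, x, hp, -, rfl, e⟩ := h₂.freeB_eq hL₂
  change b₁ (freeB m) = _
  rw [e, TensorHom.smul_units, ← treeOf_incl, b₁_treeOf p.reduced, hp, size_node]
  push_cast
  rfl

/-- The sequences `l`, `m`, `r` are elementary with products `a₁`, `a₂`, `a₃`, where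
`a = a₁ a₂ a₃` and `b` is the contribution of `a₂` to the differential of `a`. -/
def IsDiffTerm (l : Chain (freeQuiver Q) X Y) (m : Chain (freeQuiver Q) Y Z)
    (r : Chain (freeQuiver Q) Z W) (L₁ L₂ L₃ : List (PlaneTree × ℤ)) (a b : TensorHom Q X W) :
    Prop :=
  ∃ a₁ a₂ a₃, IsElementary l L₁ a₁ ∧ IsElementary m L₂ a₂ ∧ IsElementary r L₃ a₃ ∧
    mul a₁ (mul a₂ a₃) = a ∧ b = (wordDegree L₃).negOnePow • mul a₁ (mul (diff a₂) a₃)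

theorem isDiffTerm_nil {V : Q.Obj} (p : TreeIndex Q V X) (x : p.word.tensor)
    (h₁ : IsElementary l [] a₁) (h₂ : IsElementary m L₂ a₂) :
    IsDiffTerm (.nil V) (.cons (show FreeHom Q V X from treeIncl p x) l) m []
      [(p.tree, p.word.degree)] L₂ (mul (incl p.word x) (mul a₁ a₂))
      (mul (diff (incl p.word x)) (sign (mul a₁ a₂))) := by
  refine ⟨one V, _, a₂, .nil V, .cons p x h₁, h₂, ?_, ?_⟩
  · rw [TensorHom.one_mul, TensorHom.mul_assoc]
  · cases h₁
    rw [TensorHom.one_mul, TensorHom.one_mul, TensorHom.mul_one, h₂.sign_eq, TensorHom.smul_units]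

theorem IsDiffTerm.cons {V : Q.Obj} (p : TreeIndex Q V X) (x : p.word.tensor)
    {a b : TensorHom Q X W} (h : IsDiffTerm l m r L₁ L₂ L₃ a b) :
    IsDiffTerm (.cons (show FreeHom Q V X from treeIncl p x) l) m r
      ((p.tree, p.word.degree) :: L₁) L₂ L₃ (mul (incl p.word x) a) (mul (incl p.word x) b) := by
  obtain ⟨a₁, a₂, a₃, h₁, h₂, h₃, rfl, rfl⟩ := h
  refine ⟨_, a₂, a₃, .cons p x h₁, h₂, h₃, TensorHom.mul_assoc _ _ _, ?_⟩
  rw [TensorHom.smul_units, TensorHom.mul_assoc]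

/-- The iterated Leibniz rule, indexed by the same cuts of `c` as the terms with inner operation
`b₁`. -/
theorem diff_eq_sum {c : Chain (freeQuiver Q) X Y} {L : List (PlaneTree × ℤ)}
    {a : TensorHom Q X Y} (h : IsElementary c L a) :
    ∃ g : ℕ → TensorHom Q X Y, diff a = ∑ r ∈ Finset.range L.length, g r ∧
      ∀ r < L.length, IsDiffTerm (c.take r) ((c.drop r).take 1) ((c.drop r).drop 1)
        (L.take r) ((L.drop r).take 1) ((L.drop r).drop 1) a (g r) := by
  induction h with
  | nil X => exact ⟨0, TensorHom.diff_one X, by simp⟩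
  | @cons X Y Z p x c L a h ih =>
    obtain ⟨g, hg, h'⟩ := ih
    refine ⟨fun r => match r with
      | 0 => mul (diff (incl p.word x)) (sign a)
      | r + 1 => mul (incl p.word x) (g r), ?_, ?_⟩
    · rw [TensorHom.diff_mul, List.length_cons, Finset.sum_range_succ', hg, map_sum]
    · intro r hr
      cases r with
      | zero =>
        -- `c.take 0` reduces to the empty sequence only once the shape of `c` is known, so the
        -- empty part is obtained by splitting.
        obtain ⟨a', a'', h₁, h₂, rfl⟩ := h.split 0
        exact isDiffTerm_nil p x h₁ h₂
      | succ r => exact (h' r (by simpa using hr)).cons p x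

end IsElementary

-- Additivity of the left hand side of the equation

/-- The summand of the `A∞`-equation for `FQ` with inner operation `bₙ` applied after `r` entries. -/
noncomputable def aInfTerm {X Y : (freeQuiver Q).Obj} (is : List ℤ) (c : Chain (freeQuiver Q) X Y)
    (r n : ℕ) : FreeHom Q X Y :=
  (is.drop (r + n)).sum.negOnePow •
    (show FreeHom Q X Y from
      freeB ((c.take r).append (.cons (freeB ((c.drop r).take n)) ((c.drop r).drop n))))

/-- The left hand side of the `A∞`-equation for `FQ`. -/
noncomputable def aInfSum {X Y : (freeQuiver Q).Obj} (is : List ℤ) (c : Chain (freeQuiver Q) X Y) :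
    FreeHom Q X Y :=
  ∑ r ∈ Finset.range c.length, ∑ n ∈ Finset.Icc 1 (c.length - r), aInfTerm is c r n

/-- The summand of the `A∞`-equation for a decomposition of a sequence into three parts; zero if the
middle part is empty. -/
noncomputable def aInfSplit {X Y : (freeQuiver Q).Obj} (is : List ℤ) (r n : ℕ)
    {Z W : (freeQuiver Q).Obj} (l : Chain (freeQuiver Q) X Z) (m : Chain (freeQuiver Q) Z W)
    (s : Chain (freeQuiver Q) W Y) : FreeHom Q X Y :=
  if n = 0 then 0 else (is.drop (r + n)).sum.negOnePow •
    (show FreeHom Q X Y from freeB (l.append (.cons (freeB m) s)))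

section

variable {X Y Z W U V : (freeQuiver Q).Obj} (is : List ℤ) (r n : ℕ)

theorem aInfSplit_add_left (l : Chain (freeQuiver Q) X U) (x x' : FreeHom Q U V)
    (l' : Chain (freeQuiver Q) V Z) (m : Chain (freeQuiver Q) Z W)
    (s : Chain (freeQuiver Q) W Y) :
    aInfSplit is r n (l.append (.cons (x + x') l')) m s =
      aInfSplit is r n (l.append (.cons x l')) m s +
        aInfSplit is r n (l.append (.cons x' l')) m s := by
  unfold aInfSplit
  split_ifs with h
  · exact (add_zero _).symm
  · simp only [Chain.append_assoc]
    exact (congrArg _ (isAdditive_freeB l x x' (l'.append (.cons (freeB m) s)))).trans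
      (smul_add _ _ _)

theorem aInfSplit_add_mid (l : Chain (freeQuiver Q) X Z) (m : Chain (freeQuiver Q) Z U)
    (x x' : FreeHom Q U V) (m' : Chain (freeQuiver Q) V W) (s : Chain (freeQuiver Q) W Y) :
    aInfSplit is r n l (m.append (.cons (x + x') m')) s =
      aInfSplit is r n l (m.append (.cons x m')) s +
        aInfSplit is r n l (m.append (.cons x' m')) s := by
  unfold aInfSplit
  split_ifs with h
  · exact (add_zero _).symm
  · have e : freeB (m.append (.cons (x + x') m')) = _ := isAdditive_freeB m x x' m'
    rw [e]
    exact (congrArg _ (isAdditive_freeB l _ _ s)).trans (smul_add _ _ _)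

theorem aInfSplit_add_right (l : Chain (freeQuiver Q) X Z) (m : Chain (freeQuiver Q) Z W)
    (s : Chain (freeQuiver Q) W U) (x x' : FreeHom Q U V) (s' : Chain (freeQuiver Q) V Y) :
    aInfSplit is r n l m (s.append (.cons (x + x') s')) =
      aInfSplit is r n l m (s.append (.cons x s')) +
        aInfSplit is r n l m (s.append (.cons x' s')) := by
  unfold aInfSplit
  split_ifs with h
  · exact (add_zero _).symm
  · have e := isAdditive_freeB (l.append (.cons (freeB m) s)) x x' s'
    simp only [Chain.append_assoc] at e
    exact (congrArg _ e).trans (smul_add _ _ _)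

end

/-- Admitting empty middle parts, which contribute zero, turns the sum into one over all ways to cut
`c` into three pieces, the form required by two uses of `Chain.isAdditive_sum_split`. -/
theorem aInfSum_eq {X Y : (freeQuiver Q).Obj} (is : List ℤ) (c : Chain (freeQuiver Q) X Y) :
    aInfSum is c = ∑ r ∈ Finset.range (c.length + 1), ∑ n ∈ Finset.range ((c.drop r).length + 1),
      aInfSplit is r n (c.take r) ((c.drop r).take n) ((c.drop r).drop n) := by
  rw [Finset.sum_range_succ, aInfSum]
  have h0 : (c.drop c.length).length = 0 := by rw [Chain.length_drop, Nat.sub_self]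
  rw [h0, Finset.sum_range_one]
  refine (add_zero _).symm.trans (congrArg₂ _ (Finset.sum_congr rfl fun r _ => ?_) rfl)
  rw [Chain.length_drop]
  refine (Finset.sum_subset_zero_on_sdiff (fun n hn => ?_) (fun n hn => ?_)
    fun n hn => ?_)
  · simp only [Finset.mem_Icc, Finset.mem_range] at hn ⊢; omega
  · simp only [Finset.mem_sdiff, Finset.mem_Icc, Finset.mem_range] at hn
    exact if_pos (by omega)
  · simp only [Finset.mem_Icc] at hn
    exact (if_neg (by omega)).symm

theorem isAdditive_aInfSum {X Y : (freeQuiver Q).Obj} (is : List ℤ) :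
    Chain.IsAdditive (aInfSum (X := X) (Y := Y) is) := by
  rw [show aInfSum (X := X) (Y := Y) is = _ from funext (aInfSum_eq is)]
  refine Chain.isAdditive_sum_split (fun r Z l c => ∑ n ∈ Finset.range (c.length + 1),
    aInfSplit is r n l (c.take n) (c.drop n)) (fun r Z c => ?_) (fun r Z l => ?_)
  · exact Chain.isAdditive_sum _ _ fun n _ U V l x x' l' => aInfSplit_add_left _ _ _ _ _ _ _ _ _
  · exact Chain.isAdditive_sum_split (fun n W m s => aInfSplit is r n l m s)
      (fun n W s U V m x x' m' => aInfSplit_add_mid _ _ _ _ _ _ _ _ _)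
      (fun n W m U V s x x' s' => aInfSplit_add_right _ _ _ _ _ _ _ _ _)

-- Cancellation of the terms

namespace IsElementary

theorem aInfSum_of_two_le {X Y : Q.Obj} {c : Chain (freeQuiver Q) X Y}
    {L : List (PlaneTree × ℤ)} {a : TensorHom Q X Y} (h : IsElementary c L a)
    (hL : 2 ≤ L.length) : aInfSum (L.map fun p => p.2 + (p.1.size : ℤ)) c = 0 := by
  set is := L.map fun p => p.2 + (p.1.size : ℤ) with his
  set ts := L.map Prod.fst with hts
  have hlen : ts.length = L.length := List.length_map _
  have hT : (PlaneTree.node ts).Reduced := .node ts (hlen ▸ hL) h.reduced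
  have hdrop : ∀ r n, (is.drop (r + n)).sum = totalDegree ((L.drop r).drop n) := by
    intro r n
    rw [totalDegree_eq_sum, his, List.map_drop, List.map_drop, List.drop_drop]
  have hcat : ∀ r n, L.take r ++ ((L.drop r).take n ++ (L.drop r).drop n) = L := by
    intro r n
    rw [List.take_append_drop, List.take_append_drop]
  let s : ℤˣ := (koszul L).negOnePow
  let f : PlaneTree × ℕ → FreeHom Q X Y := fun e => (1 + e.2 : ℤ).negOnePow • treeOf e.1 a
  obtain ⟨g, hg, hg'⟩ := h.diff_eq_sum
  have inner : ∀ r ∈ Finset.range L.length, aInfTerm is c r 1 =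
      s • -((1 + vertices L : ℤ).negOnePow • treeOf (.node ts) (g r) +
        ∑ e ∈ (ts.getD r .leaf).edgeInsertions,
          f (.node (ts.take r ++ e.1 :: ts.drop (r + 1)),
            1 + PlaneTree.forestSize (ts.take r) + e.2)) := by
    intro r hr
    rw [Finset.mem_range] at hr
    obtain ⟨a₁, a₂, a₃, h₁, h₂, h₃, e, hgr⟩ := hg' r hr
    have hone : (L.drop r).take 1 = [(L[r].1, L[r].2)] := by
      rw [List.drop_eq_getElem_cons hr, List.take_succ_cons, List.take_zero]
    have := h₁.freeB_freeB_inner h₂ h₃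
      (by simp only [List.length_take, List.length_drop]; omega) hone
    rw [hcat, ← hdrop, e] at this
    refine this.trans ?_
    have hget : ts.getD r .leaf = L[r].1 := by
      rw [List.getD_eq_getElem _ _ (hlen ▸ hr), List.getElem_map]
    have htake : ts.take r = (L.take r).map Prod.fst := by rw [List.map_take]
    have hdrop' : ts.drop (r + 1) = ((L.drop r).drop 1).map Prod.fst := by
      rw [List.drop_drop, List.map_drop]
    rw [hgr, hget, htake, hdrop']
    refine congrArg _ ?_
    rw [TensorHom.smul_units, negOnePow_smul_smul, neg_add, ← Units.neg_smul,
      ← Int.negOnePow_succ, ← Finset.sum_neg_distrib]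
    refine congrArg₂ _ (negOnePow_smul_eq _ (-1) (by ring)) (Finset.sum_congr rfl fun e _ => ?_)
    rw [← Units.neg_smul, ← Int.negOnePow_succ]
    -- In the grafted tree the edge has height `1 + vertices L₁ + h`, where `L₁` lists the entries
    -- to the left. Its sign in the outer `b₁` has exponent one larger than the sign found here.
    refine negOnePow_smul_eq _ (-1) ?_
    simp only [vertices]
    push_cast
    ring
  have join : ∀ x ∈ ((Finset.range L.length).sigma fun r => Finset.Icc 2 (L.length - r)).erase
      ⟨0, L.length⟩, aInfTerm is c x.1 x.2 =
        s • -f (.node (ts.take x.1 ++ .node ((ts.drop x.1).take x.2) :: (ts.drop x.1).drop x.2),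
          1 + PlaneTree.forestSize (ts.take x.1) + 1) := by
    rintro ⟨r, n⟩ hx
    simp only [Finset.mem_erase, Finset.mem_sigma, Finset.mem_range, Finset.mem_Icc, ne_eq,
      Sigma.mk.injEq, heq_eq_eq] at hx
    obtain ⟨a₁, a', h₁, h', e⟩ := h.split r
    obtain ⟨a₂, a₃, h₂, h₃, rfl⟩ := h'.split n
    have := h₁.freeB_freeB_join h₂ h₃
      (by simp only [List.length_take, List.length_drop]; omega)
      (by simp only [List.length_take, List.length_drop]; omega)
    rw [hcat, ← hdrop, e] at this
    refine this.trans (congrArg _ ?_)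
    simp only [f, ts, ← List.map_take, ← List.map_drop]
    rw [← Units.neg_smul, ← Int.negOnePow_succ]
    -- The joining vertex has height `vertices L₁ + 2`, so its sign in the outer `b₁` has exponent
    -- `vertices L₁ + 3`, opposite to that of the inner operation.
    refine negOnePow_smul_eq _ (-2) ?_
    simp only [vertices]
    push_cast
    ring
  have outer : aInfTerm is c 0 L.length =
      s • ((1 + vertices L : ℤ).negOnePow • treeOf (.node ts) (diff a) +
        ∑ e ∈ (PlaneTree.node ts).edgeInsertions, f e) := by
    obtain ⟨a₁, a', h₁, h', e⟩ := h.split 0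
    obtain ⟨a₂, a₃, h₂, h₃, rfl⟩ := h'.split L.length
    rw [List.drop_zero, List.drop_length] at h₃
    rw [List.drop_zero, List.take_length] at h₂
    have := freeB_freeB_outer h₁ h₂ h₃ hL
    rw [e] at this
    have h0 : (is.drop (0 + L.length)).sum.negOnePow = 1 := by
      rw [hdrop, List.drop_zero, List.drop_length]
      simp [totalDegree, wordDegree, vertices, PlaneTree.forestSize]
    refine Eq.trans ?_ this
    refine (congrArg (fun u : ℤˣ => u • (show FreeHom Q X Y from _)) h0).trans (one_smul _ _)
  -- The pairs `(r, n)` are sorted into `n = 1`, the whole sequence, and the remaining ones with `n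
  -- ≥ 2`; the last set is the index set of the joining insertions in `sum_edgeInsertions_node`.
  have hsum : aInfSum is c = ∑ r ∈ Finset.range L.length, aInfTerm is c r 1 +
      (aInfTerm is c 0 L.length + ∑ x ∈ ((Finset.range L.length).sigma fun r =>
        Finset.Icc 2 (L.length - r)).erase ⟨0, L.length⟩, aInfTerm is c x.1 x.2) := by
    have hmem : (⟨0, L.length⟩ : (_ : ℕ) × ℕ) ∈
        (Finset.range L.length).sigma fun r => Finset.Icc 2 (L.length - r) := by
      simp only [Finset.mem_sigma, Finset.mem_range, Finset.mem_Icc]; omega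
    have hS : aInfSum is c = ∑ r ∈ Finset.range c.length, ∑ n ∈ Finset.Icc 1 (c.length - r),
      aInfTerm is c r n := rfl
    rw [Finset.add_sum_erase _ (fun x => aInfTerm is c x.1 x.2) hmem, Finset.sum_sigma,
      ← Finset.sum_add_distrib, hS, h.length_eq]
    refine Finset.sum_congr rfl fun r hr => ?_
    rw [Finset.mem_range] at hr
    rw [← Finset.add_sum_Ioc_eq_sum_Icc (by omega)]
    rfl
  rw [hsum, outer, Finset.sum_congr rfl inner, Finset.sum_congr rfl join,
    PlaneTree.sum_edgeInsertions_node ts hT f, hg, hlen, map_sum]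
  simp only [← units_smul_sum, ← smul_add, Finset.sum_neg_distrib, Finset.sum_add_distrib]
  convert smul_zero s using 2
  abel

end IsElementary

theorem IsElementary.aInfSum_eq_zero {X Y : Q.Obj} {c : Chain (freeQuiver Q) X Y}
    {L : List (PlaneTree × ℤ)} {a : TensorHom Q X Y} (h : IsElementary c L a) :
    aInfSum (L.map fun p => p.2 + (p.1.size : ℤ)) c = 0 := by
  rcases Nat.lt_or_ge 1 L.length with hL | hL
  · exact h.aInfSum_of_two_le hL
  · cases h with
    | nil => rfl
    | cons p x h =>
      cases h with
      | nil =>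
        refine (Finset.sum_range_one _).trans ((Finset.sum_singleton _ 1).trans ?_)
        refine (congrArg _ (b₁_b₁ (treeIncl p x))).trans (smul_zero _)
      | cons => simp at hL

theorem isAInfCategory_freeQuiver (Q : DGQuiver.{u, v} k) :
    IsAInfCategory (freeQuiver Q) freeB where
  b_nil X := rfl
  b_add l x x' r := isAdditive_freeB l x x' r
  b_smul l a x r := by
    obtain ⟨φ, h⟩ := exists_freeB_slot l r
    exact (h _).trans ((map_smul φ a x).trans (congrArg (a • ·) (h x).symm))
  b_mem := freeB_mem
  b_b c is hc := by
    -- Vanishing is membership in the zero subgroup.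
    have := mem_of_isElementary ⊥ (isAdditive_aInfSum is) is
      (fun c L a h hL => by
        rw [← hL]
        exact AddSubgroup.mem_bot.2 h.aInfSum_eq_zero) c hc
    exact AddSubgroup.mem_bot.1 this

end FreeCategory

end FreeAInf

theorem mainTheorem7 {k : Type u} [CommRing k] (Q : FreeAInf.DGQuiver.{u, v} k) :
    FreeAInf.IsAInfCategory (FreeAInf.freeQuiver Q) FreeAInf.freeB :=
  FreeAInf.isAInfCategory_freeQuiver Q
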